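/- Let $\mathfrak g$ be a complex simple (finite-dimensional) Lie algebra, $\mathfrak h$ a Cartan subalgebra, $R$ the set of roots of $(\mathfrak g,\mathfrak h)$, $\Pi$ a base of $R$, and $R^+$ the corresponding set of positive roots. For each $\alpha\in R$ let $\mathfrak g_\alpha$ be its root space and fix a non-zero root vector $X_\alpha\in\mathfrak g_\alpha$. For $S\subset\Pi$ put $R_S=R\cap\mathbb Z S$, $R_S^1=R^+\setminus R_S$, $$\mathfrak u_S=\bigoplus_{\alpha\in R_S^1}\mathfrak g_\alpha,\qquad \mathfrak u_S^-=\bigoplus_{\alpha\in R_S^1}\mathfrak g_{-\alpha},\qquad \mathfrak k_S=\mathfrak h\oplus\bigoplus_{\alpha\in R_S}\mathfrak g_\alpha,\qquad \mathfrak p_S=\mathfrak u_S\oplus\mathfrak u_S^-,$$ so that $\mathfrak u_S$ is the unipotent radical of the standard parabolic subalgebra $\mathfrak q_S=\mathfrak h\oplus\bigoplus_{\alpha\in R_S\cup R^+}\mathfrak g_\alpha$. For a non-empty connected subset $T$ of $\Pi$ (connected in the Dynkin diagram), let $\varepsilon_T$ be the highest root of $R_T$. For $T\subset\Pi$ define a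 set $\mathcal K(T)$ of subsets of $T$ by induction on the cardinality of $T$: $\mathcal K(\emptyset)=\emptyset$; if $T_1,\dots,T_r$ are the connected components of $T$, then $\mathcal K(T)=\mathcal K(T_1)\cup\dots\cup\mathcal K(T_r)$; and if $T$ is connected and non-empty, then $\mathcal K(T)=\{T\}\cup\mathcal K(\{\alpha\in T : \alpha\perp\varepsilon_T\})$. For $K\in\mathcal K(\Pi)$ let $\Gamma^K$ be the set of roots in $R_K\cap R^+$ which are not orthogonal to $\varepsilon_K$. A Cartan subspace of a subspace $\mathfrak p$ of $\mathfrak g$ is a subspace of $\mathfrak p$ that is maximal among the abelian subspaces of $\mathfrak p$ consisting of semisimple elements. If $\theta$ is an automorphism of $\mathfrak g$ with $\theta^2=1$, fixed point set $\mathfrak k$ and $(-1)$-eigenspace $\mathfrak p$, then $(\mathfrak g,\mathfrak k)$ is called a symmetric pair, and its rank is the common dimension of all Cartan subspaces of $\mathfrak p$. **Proposition 2.1.** Let $S\subset\Pi$ be such that $\mathfrak u_S$ is abelian, let $\mathcal E=\{K\in\mathcal K(\Pi) : \varepsilon_K\in R_S^1\}$, and for $K\in\mathcal E$ let $X_K=X_{\varepsilon_K}+X_{-\varepsilon_K}$.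 Then: 1. $R_S^1\subset\bigcup_{K\in\mathcal E}\Gamma^K$. 2. If $K\in\mathcal E$ and $\alpha\in R_S^1\cap\Gamma^K$, then $\varepsilon_K-\alpha\notin R_S^1$. 3. The subspace spanned by the $X_K$, $K\in\mathcal E$, is a Cartan subspace of $\mathfrak p_S$; moreover $(\mathfrak g,\mathfrak k_S)$ is a symmetric pair, and its rank is $\#\mathcal E$. -/

import Mathlib

noncomputable section

namespace RootPairing.Base

variable {ι R M N : Type*} [CommRing R] [AddCommGroup M] [Module R M] [AddCommGroup N] [Module R N]
  {P : RootPairing ι R M N}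

/-- `R_T = R ∩ ℤT`, the roots which are integral combinations of the set `T` of (simple) roots. -/
def subRoots (_b : P.Base) (T : Finset ι) : Set ι :=
  {i | P.root i ∈ Submodule.span ℤ (P.root '' (T : Set ι))}

/-- The Dynkin graph: distinct roots are joined when they are not orthogonal.
It is only used on sets of simple roots. -/
def dynkinGraph (_b : P.Base) : SimpleGraph ι where
  Adj i j := i ≠ j ∧ ¬ P.IsOrthogonal i j
  symm := ⟨fun _ _ h ↦ ⟨h.1.symm, fun h' ↦ h.2 h'.symm⟩⟩
  loopless := ⟨fun _ h ↦ h.1 rfl⟩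

/-- A set of simple roots is connected if its Dynkin diagram is (in particular, it is non-empty). -/
def IsConnectedSet (b : P.Base) (T : Finset ι) : Prop :=
  (b.dynkinGraph.induce (T : Set ι)).Connected

/-- `C` is a connected component of `T`: a maximal connected subset. -/
def IsComponent (b : P.Base) (T C : Finset ι) : Prop :=
  Maximal (fun D : Finset ι ↦ D ⊆ T ∧ b.IsConnectedSet D) C

/-- `i` is the highest root of `R_T` with respect to the base `T`: it lies in `R_T`, and
`root i - root j` is a sum of elements of `T` for every root `j` of `R_T`. -/
def IsHighestRoot (b : P.Base) (T : Finset ι) (i : ι) : Prop :=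
  i ∈ b.subRoots T ∧
    ∀ j ∈ b.subRoots T, P.root i - P.root j ∈ AddSubmonoid.closure (P.root '' (T : Set ι))

/-- `ε_T`, the highest root of `R_T`. This is only meaningful (and only used) when `T` is connected,
in which case the highest root exists and is unique. -/
def highestRoot [Nonempty ι] (b : P.Base) (T : Finset ι) : ι :=
  Classical.epsilon (b.IsHighestRoot T)

open Classical in
/-- `b.Cascade T K` means that `K` belongs to the cascade `𝒦(T)` of the set `T` of simple roots:
`𝒦(T)` is the union of the `𝒦(C)`, over the connected components `C` of `T`, and for connected `T`,
it is `{T} ∪ 𝒦({α ∈ T ; α orthogonal to ε_T})`. In particular `𝒦(∅)` is empty. -/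
inductive Cascade [Nonempty ι] (b : P.Base) : Finset ι → Finset ι → Prop
  | component {T C K : Finset ι} (hC : b.IsComponent T C) (hK : Cascade b C K) : Cascade b T K
  | self {T : Finset ι} (hT : b.IsConnectedSet T) : Cascade b T T
  | orthogonal {T K : Finset ι} (hT : b.IsConnectedSet T)
      (hK : Cascade b {i ∈ T | P.IsOrthogonal i (b.highestRoot T)} K) : Cascade b T K

variable [CharZero R] [IsDomain R] [Finite ι] [P.IsCrystallographic] [P.IsReduced]

/-- `R_S¹ = R⁺ \ R_S`. -/
def nilRoots (b : P.Base) (S : Finset ι) : Set ι := {i | b.IsPos i ∧ i ∉ b.subRoots S}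

/-- `Γ^K`, the set of positive roots of `R_K` which are not orthogonal to `ε_K`. -/
def cascadeGamma [Nonempty ι] (b : P.Base) (K : Finset ι) : Set ι :=
  {i | b.IsPos i ∧ i ∈ b.subRoots K ∧ ¬ P.IsOrthogonal i (b.highestRoot K)}

/-- `ℰ`, the set of those `K ∈ 𝒦(Π)` for which `ε_K ∈ R_S¹`. -/
def cascadeE [Nonempty ι] (b : P.Base) (S : Finset ι) : Set (Finset ι) :=
  {K | b.Cascade b.support K ∧ b.highestRoot K ∈ b.nilRoots S}

end RootPairing.Base

namespace SymmetricPair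

variable {L : Type*} [LieRing L] [LieAlgebra ℂ L]

/-- A Cartan subspace of `p`: a subspace of `p` which is maximal among those which are abelian and
consist of (`ad`-)semisimple elements. -/
def IsCartanSubspace (p a : Submodule ℂ L) : Prop :=
  Maximal (fun c : Submodule ℂ L ↦ c ≤ p ∧ (∀ x ∈ c, ∀ y ∈ c, ⁅x, y⁆ = 0) ∧
    ∀ x ∈ c, (LieAlgebra.ad ℂ L x).IsSemisimple) a

/-- `(L, k)` is a symmetric pair, that is `k` is the fixed point set of an automorphism `θ` of `L`
with `θ² = 1`, and its rank is `r`: Cartan subspaces of the `(-1)`-eigenspace of `θ` exist and all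
of them have dimension `r`. -/
def HasRank (k : Submodule ℂ L) (r : ℕ) : Prop :=
  ∃ θ : L ≃ₗ⁅ℂ⁆ L, (∀ x, θ (θ x) = x) ∧ (∀ x, x ∈ k ↔ θ x = x) ∧
    ∃ p : Submodule ℂ L, (∀ x, x ∈ p ↔ θ x = -x) ∧
      (∃ a, IsCartanSubspace p a) ∧ ∀ a, IsCartanSubspace p a → Module.finrank ℂ a = r

end SymmetricPair

namespace StandardParabolic

open LieAlgebra LieAlgebra.IsKilling

variable {L : Type*} [LieRing L] [LieAlgebra ℂ L] [FiniteDimensional ℂ L] [IsSimple ℂ L]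
  {H : LieSubalgebra ℂ L} [H.IsCartanSubalgebra]

instance nonempty_root : Nonempty H.root := by
  have : Nontrivial (Module.Dual ℂ H) := (instIsIrreducibleRootSystem_of_isSimple (H := H)).nontrivial
  by_contra h
  rw [not_nonempty_iff] at h
  have h1 := RootPairing.IsRootSystem.span_root_eq_top (P := rootSystem H)
  rw [Set.range_eq_empty, Submodule.span_empty] at h1
  exact bot_ne_top h1

/-- `u_S`, the sum of the root spaces `g_α` for `α ∈ R_S¹`: the unipotent radical of the standard
parabolic subalgebra `q_S = h ⊕ ⨁_{α ∈ R_S ∪ R⁺} g_α`. -/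
def u (b : (rootSystem H).Base) (S : Finset H.root) : Submodule ℂ L :=
  ⨆ α ∈ b.nilRoots S, (rootSpace H (α : LieModule.Weight ℂ H L)).toSubmodule

/-- `u_S⁻`, the sum of the root spaces `g_{-α}` for `α ∈ R_S¹`. -/
def uMinus (b : (rootSystem H).Base) (S : Finset H.root) : Submodule ℂ L :=
  ⨆ α ∈ b.nilRoots S, (rootSpace H (-(α : LieModule.Weight ℂ H L))).toSubmodule

/-- `k_S = h ⊕ ⨁_{α ∈ R_S} g_α`. -/
def k (b : (rootSystem H).Base) (S : Finset H.root) : Submodule ℂ L :=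
  H.toSubmodule ⊔
    ⨆ α ∈ b.subRoots S, (rootSpace H (α : LieModule.Weight ℂ H L)).toSubmodule

/-- `p_S = u_S ⊕ u_S⁻`. -/
def p (b : (rootSystem H).Base) (S : Finset H.root) : Submodule ℂ L := u b S ⊔ uMinus b S

/-- The subspace spanned by the elements `X_K = X_{ε_K} + X_{-ε_K}`, `K ∈ ℰ`, for a family `X` of
root vectors. -/
def cascadeSpan (b : (rootSystem H).Base) (S : Finset H.root) (X : LieModule.Weight ℂ H L → L) :
    Submodule ℂ L :=
  Submodule.span ℂ ((fun K : Finset H.root ↦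
    X (b.highestRoot K : LieModule.Weight ℂ H L) +
      X (-(b.highestRoot K : LieModule.Weight ℂ H L))) '' b.cascadeE S)

end StandardParabolic

end

/-!
Roots are handled through their integral coordinates in the base `b` (`RootPairing.Base.coeff`):
a root belongs to `R_T` when its coordinates outside of `T` vanish, and the highest root `ε_T` of a
connected `T` exists and dominates all roots of `R_T` coordinatewise
(`RootPairing.Base.exists_isHighestRoot`). It is dominant, so that a positive root of `R_T`
orthogonal to it is a combination of simple roots orthogonal to it; since the support of a positive
root is connected, descending through the cascade shows that every positive root lies in some `Γ^K`
(`RootPairing.Base.exists_cascade_mem_cascadeGamma`), and that the roots `ε_K` are pairwise strongly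
orthogonal (`RootPairing.Base.Cascade.isStronglyOrthogonal`).

If `α ∈ R_S¹ ∩ Γ^K`, then `ε_K` has a positive coordinate outside of `S` because `α` has one, so
`K ∈ ℰ`: this is the first assertion. Brackets of root vectors do not vanish when the sum of the
roots is a root (`LieAlgebra.IsKilling.lie_ne_zero_of_rootSpace_add_ne_bot`), so that `u_S` abelian
means that sums of two elements of `R_S¹` are never roots. This gives the second assertion, and also
the relations `[k_S, k_S] ⊆ k_S`, `[k_S, p_S] ⊆ p_S` and `[p_S, p_S] ⊆ k_S`, whence the involution
(`StandardParabolic.exists_involution_of_abelian`).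

By strong orthogonality the `X_K` commute, and each of them is semisimple, being conjugate to a
multiple of a coroot by exponentials in `𝔰𝔩₂`
(`LieAlgebra.IsKilling.isSemisimple_ad_add_of_mem_rootSpace`). An element `y` of `p_S` which
commutes with `X_K` has no component at `±α` for `α ∈ R_S¹ ∩ Γ^K` different from `ε_K`, because
`α - ε_K` is a root while `α - 2ε_K` is not, and its components at `±ε_K` add up to a multiple of
`X_K`. As the `Γ^K` cover `R_S¹`, the span of the `X_K` is its own centralizer in `p_S`
(`StandardParabolic.mem_cascadeSpan_of_forall_lie_eq_zero`), hence a Cartan subspace, of dimension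
`#ℰ`.

The statement on the rank needs in addition that all Cartan subspaces of `p` have the same
dimension, for an arbitrary involution of a Lie algebra with non-degenerate Killing form
(`SymmetricPair.IsCartanSubspace.finrank_eq`). A Cartan subspace `a` is its own centralizer in `p`,
by the Jordan decomposition and the non-degeneracy of the Killing form on centralizers, and it
contains an element `x` whose centralizer in `p` is `a`. Then `p = [k, x] ⊕ a`, and the open mapping
theorem for `(w, c) ↦ exp (ad w) c` shows that all points of `p` near `x` are conjugate to elements
of `a`. Comparing the rank of `ad` on `k` at such a point, chosen on the line through `x` and a
regular element of another Cartan subspace `a'`, gives `dim a ≤ dim a'`.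
-/

set_option linter.unusedSectionVars false

noncomputable section

namespace RootPairing.Base

variable {ι R M N : Type*} [CommRing R] [AddCommGroup M] [Module R M] [AddCommGroup N] [Module R N]
  {P : RootPairing ι R M N} [CharZero R] (b : P.Base)

/-! ### Integral coordinates of roots -/

/-- The coordinates of the root `P.root i` with respect to the base `b`, extended by zero to all
indices outside of `b.support`. -/
def coeff (i : ι) : ι → ℤ := (b.exists_root_eq_sum_int i).choose

lemma root_eq_sum_coeff (i : ι) : P.root i = ∑ j ∈ b.support, b.coeff i j • P.root j :=
  (b.exists_root_eq_sum_int i).choose_spec.2.2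

lemma coeff_eq_zero_of_notMem (i : ι) {j : ι} (hj : j ∉ b.support) : b.coeff i j = 0 := by
  by_contra h
  exact hj ((b.exists_root_eq_sum_int i).choose_spec.1 h)

lemma coeff_pos_or_neg (i : ι) : 0 < b.coeff i ∨ b.coeff i < 0 :=
  (b.exists_root_eq_sum_int i).choose_spec.2.1

lemma eq_of_sum_eq_sum {f g : ι → ℤ}
    (h : ∑ j ∈ b.support, f j • P.root j = ∑ j ∈ b.support, g j • P.root j) {j : ι}
    (hj : j ∈ b.support) : f j = g j := by
  rw [b.support.sum_subtype (p := (· ∈ b.support)) (by simp) (F := inferInstance),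
    b.support.sum_subtype (p := (· ∈ b.support)) (by simp) (F := inferInstance)] at h
  exact Fintype.linearIndependent_iffₛ.mp
      (b.linearIndepOn_root.restrict_scalars' ℤ) (f ∘ (↑)) (g ∘ (↑)) (by simpa) ⟨j, hj⟩

lemma coeff_eq_of_root_eq_sum {i : ι} {f : ι → ℤ} (hf : ∀ j ∉ b.support, f j = 0)
    (h : P.root i = ∑ j ∈ b.support, f j • P.root j) : b.coeff i = f := by
  ext j
  by_cases hj : j ∈ b.support
  · exact b.eq_of_sum_eq_sum ((b.root_eq_sum_coeff i).symm.trans h) hj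
  · rw [b.coeff_eq_zero_of_notMem i hj, hf j hj]

lemma coeff_add {i j k : ι} (h : P.root k = P.root i + P.root j) :
    b.coeff k = b.coeff i + b.coeff j := by
  refine b.coeff_eq_of_root_eq_sum (fun l hl ↦ ?_) ?_
  · simp [b.coeff_eq_zero_of_notMem _ hl]
  · simp only [Pi.add_apply, add_smul, Finset.sum_add_distrib]
    rw [h, ← b.root_eq_sum_coeff, ← b.root_eq_sum_coeff]

lemma coeff_neg {i j : ι} (h : P.root j = -P.root i) : b.coeff j = -b.coeff i := by
  refine b.coeff_eq_of_root_eq_sum (fun l hl ↦ ?_) ?_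
  · simp [b.coeff_eq_zero_of_notMem _ hl]
  · simp only [Pi.neg_apply, neg_smul, Finset.sum_neg_distrib]
    rw [h, ← b.root_eq_sum_coeff]

lemma coeff_sub {i j k : ι} (h : P.root k = P.root i - P.root j) :
    b.coeff k = b.coeff i - b.coeff j := by
  rw [eq_sub_iff_add_eq, ← b.coeff_add (i := k) (j := j) (k := i) (by rw [h]; abel)]

lemma coeff_self {i : ι} (hi : i ∈ b.support) [DecidableEq ι] : b.coeff i = Pi.single i 1 := by
  refine b.coeff_eq_of_root_eq_sum (fun l hl ↦ ?_) ?_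
  · rw [Pi.single_apply, if_neg]
    rintro rfl
    exact hl hi
  · rw [Finset.sum_eq_single_of_mem i hi (fun j _ hj ↦ by simp [Pi.single_eq_of_ne hj])]
    simp

lemma height_eq_sum_coeff (i : ι) : b.height i = ∑ j ∈ b.support, b.coeff i j :=
  height_eq_sum (b.root_eq_sum_coeff i)

lemma root_injective_of_coeff {i j : ι} (h : b.coeff i = b.coeff j) : i = j :=
  P.root.injective (by rw [b.root_eq_sum_coeff i, b.root_eq_sum_coeff j, h])

lemma isPos_iff_coeff_nonneg {i : ι} : b.IsPos i ↔ 0 ≤ b.coeff i := by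
  constructor
  · intro h
    rcases b.coeff_pos_or_neg i with h' | h'
    · exact h'.le
    · rw [isPos_iff, height_eq_sum_coeff] at h
      exact absurd h (not_lt.mpr (Finset.sum_nonpos fun j _ ↦ h'.le j))
  · intro h
    rw [isPos_iff', height_eq_sum_coeff]
    exact Finset.sum_nonneg fun j _ ↦ h j

lemma isPos_of_coeff_pos {i j : ι} (h : 0 < b.coeff i j) : b.IsPos i := by
  rw [isPos_iff_coeff_nonneg]
  rcases b.coeff_pos_or_neg i with h' | h'
  · exact h'.le
  · exact absurd (h'.le j) (not_le.mpr h)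

lemma sum_mem_closure {T : Finset ι} {f : ι → ℤ} (h0 : 0 ≤ f) (hf : ∀ j ∉ T, f j = 0) :
    ∑ j ∈ b.support, f j • P.root j ∈ AddSubmonoid.closure (P.root '' (T : Set ι)) := by
  refine sum_mem fun j _ ↦ ?_
  by_cases hj : j ∈ T
  · obtain ⟨n, hn⟩ := Int.eq_ofNat_of_zero_le (h0 j)
    rw [hn, natCast_zsmul]
    exact nsmul_mem (AddSubmonoid.subset_closure (Set.mem_image_of_mem _ hj)) _
  · simp [hf j hj]

lemma exists_of_mem_closure {T : Finset ι} (hT : T ⊆ b.support) {m : M}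
    (hm : m ∈ AddSubmonoid.closure (P.root '' (T : Set ι))) :
    ∃ f : ι → ℤ, 0 ≤ f ∧ (∀ j ∉ T, f j = 0) ∧ m = ∑ j ∈ b.support, f j • P.root j := by
  classical
  induction hm using AddSubmonoid.closure_induction with
  | mem x hx =>
    obtain ⟨j, hj, rfl⟩ := hx
    have hj' : j ∈ T := hj
    refine ⟨b.coeff j, ?_, fun l hl ↦ ?_, b.root_eq_sum_coeff j⟩
    · exact b.isPos_iff_coeff_nonneg.mp (isPos_of_mem_support (hT hj'))
    · rw [b.coeff_self (hT hj')]
      rw [Pi.single_apply, if_neg]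
      rintro rfl
      exact hl hj'
  | zero => exact ⟨0, le_rfl, by simp, by simp⟩
  | add x y _ _ hx hy =>
    obtain ⟨f, hf, hf', rfl⟩ := hx
    obtain ⟨g, hg, hg', rfl⟩ := hy
    exact ⟨f + g, add_nonneg hf hg, fun j hj ↦ by simp [hf' j hj, hg' j hj],
      by simp [add_smul, Finset.sum_add_distrib]⟩

lemma mem_subRoots_iff {T : Finset ι} (hT : T ⊆ b.support) {i : ι} :
    i ∈ b.subRoots T ↔ ∀ j ∉ T, b.coeff i j = 0 := by
  classical
  constructor
  · intro h
    suffices ∀ m ∈ Submodule.span ℤ (P.root '' (T : Set ι)), ∃ f : ι → ℤ, (∀ j ∉ T, f j = 0) ∧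
        m = ∑ j ∈ b.support, f j • P.root j by
      obtain ⟨f, hf, hf'⟩ := this _ h
      rw [b.coeff_eq_of_root_eq_sum (fun j hj ↦ hf j fun h ↦ hj (hT h)) hf']
      exact hf
    intro m hm
    induction hm using Submodule.span_induction with
    | mem x hx =>
      obtain ⟨j, hj, rfl⟩ := hx
      have hj' : j ∈ T := hj
      refine ⟨b.coeff j, fun l hl ↦ ?_, b.root_eq_sum_coeff j⟩
      rw [b.coeff_self (hT hj')]
      rw [Pi.single_apply, if_neg]
      rintro rfl
      exact hl hj'
    | zero => exact ⟨0, by simp, by simp⟩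
    | add x y _ _ hx hy =>
      obtain ⟨f, hf', rfl⟩ := hx
      obtain ⟨g, hg', rfl⟩ := hy
      exact ⟨f + g, fun j hj ↦ by simp [hf' j hj, hg' j hj],
        by simp [add_smul, Finset.sum_add_distrib]⟩
    | smul a x _ hx =>
      obtain ⟨f, hf', rfl⟩ := hx
      exact ⟨a • f, fun j hj ↦ by simp [hf' j hj], by simp [Finset.smul_sum, mul_smul]⟩
  · intro h
    show P.root i ∈ Submodule.span ℤ (P.root '' (T : Set ι))
    rw [b.root_eq_sum_coeff i]
    refine Submodule.sum_mem _ fun j _ ↦ ?_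
    by_cases hj : j ∈ T
    · exact Submodule.smul_mem _ _ (Submodule.subset_span ⟨j, hj, rfl⟩)
    · simp [h j hj]

lemma mem_subRoots_of_mem {T : Finset ι} {i : ι} (hi : i ∈ T) : i ∈ b.subRoots T :=
  Submodule.subset_span ⟨i, hi, rfl⟩

lemma isHighestRoot_iff {T : Finset ι} (hT : T ⊆ b.support) {i : ι} :
    b.IsHighestRoot T i ↔ i ∈ b.subRoots T ∧ ∀ j ∈ b.subRoots T, b.coeff j ≤ b.coeff i := by
  refine and_congr_right fun hi ↦ forall₂_congr fun j hj ↦ ?_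
  have key : P.root i - P.root j = ∑ k ∈ b.support, (b.coeff i - b.coeff j) k • P.root k := by
    simp only [Pi.sub_apply, sub_smul, Finset.sum_sub_distrib]
    rw [← b.root_eq_sum_coeff, ← b.root_eq_sum_coeff]
  constructor
  · intro h
    obtain ⟨f, hf, hf', hs⟩ := b.exists_of_mem_closure hT h
    intro k
    by_cases hk : k ∈ b.support
    · have := b.eq_of_sum_eq_sum (key.symm.trans hs) hk
      have h0 := hf k
      simp only [Pi.sub_apply, Pi.zero_apply] at this h0
      lia
    · simp [b.coeff_eq_zero_of_notMem _ hk]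
  · intro h
    rw [key]
    refine b.sum_mem_closure (sub_nonneg.mpr h) fun k hk ↦ ?_
    rw [Pi.sub_apply, (b.mem_subRoots_iff hT).mp hi k hk, (b.mem_subRoots_iff hT).mp hj k hk,
      sub_zero]

variable [IsDomain R] [Finite ι] [P.IsCrystallographic]

lemma pairingIn_eq_sum_coeff (i k : ι) :
    P.pairingIn ℤ i k = ∑ j ∈ b.support, b.coeff i j * P.pairingIn ℤ j k :=
  FaithfulSMul.algebraMap_injective ℤ R <| by
    simp_rw [map_sum, map_mul, algebraMap_pairingIn, ← root_coroot_eq_pairing]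
    conv_lhs => rw [b.root_eq_sum_coeff i]
    simp [map_sum, LinearMap.sum_apply]

lemma _root_.RootPairing.isOrthogonal_iff_pairingIn {i j : ι} :
    P.IsOrthogonal i j ↔ P.pairingIn ℤ i j = 0 := by
  have : Module.IsReflexive R M := .of_isPerfPair P.toLinearMap
  rw [IsOrthogonal, ← P.algebraMap_pairingIn ℤ, ← P.algebraMap_pairingIn ℤ,
    FaithfulSMul.algebraMap_eq_zero_iff, FaithfulSMul.algebraMap_eq_zero_iff,
    P.pairingIn_eq_zero_iff (i := j), and_self]

/-! ### Connected sets of simple roots -/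

lemma IsConnectedSet.induction {T : Finset ι} (hT : b.IsConnectedSet T) {Q : ι → Prop} {a : ι}
    (ha : a ∈ T) (h0 : Q a)
    (h : ∀ i ∈ T, ∀ j ∈ T, Q i → ¬ P.IsOrthogonal i j → Q j) : ∀ i ∈ T, Q i := by
  intro i hi
  have := hT.preconnected ⟨a, ha⟩ ⟨i, hi⟩
  rw [SimpleGraph.reachable_iff_reflTransGen] at this
  suffices ∀ x : ((T : Set ι) : Type _), Relation.ReflTransGen
      (b.dynkinGraph.induce (T : Set ι)).Adj ⟨a, ha⟩ x → Q x from this _ ‹_›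
  intro x hx
  induction hx with
  | refl => exact h0
  | tail _ hadj ih => exact h _ (Subtype.property _) _ (Subtype.property _) ih hadj.2

lemma IsConnectedSet.nonempty {T : Finset ι} (hT : b.IsConnectedSet T) : T.Nonempty := by
  obtain ⟨x⟩ := SimpleGraph.Connected.nonempty hT
  exact ⟨x, x.2⟩

open Classical in
/-- Two connected sets containing non-orthogonal (possibly equal) roots have connected union. -/
lemma IsConnectedSet.union {T U : Finset ι} (hT : b.IsConnectedSet T) (hU : b.IsConnectedSet U)
    {i j : ι} (hi : i ∈ T) (hj : j ∈ U) (hij : ¬ P.IsOrthogonal i j) :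
    b.IsConnectedSet (T ∪ U) := by
  unfold IsConnectedSet at *
  rw [Finset.coe_union]
  by_cases h : i = j
  · subst h
    exact SimpleGraph.induce_union_connected hT.preconnected hU.preconnected ⟨i, hi, hj⟩
  · exact SimpleGraph.connected_induce_union hT.preconnected hU.preconnected hi hj ⟨h, hij⟩

lemma isConnectedSet_singleton (i : ι) : b.IsConnectedSet {i} := by
  unfold IsConnectedSet
  rw [Finset.coe_singleton]
  have : Subsingleton (({i} : Set ι) : Type _) := inferInstance
  exact { preconnected := .of_subsingleton, nonempty := ⟨⟨i, rfl⟩⟩ }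

end RootPairing.Base

namespace RootPairing.Base

variable {ι R M N : Type*} [CommRing R] [AddCommGroup M] [Module R M] [AddCommGroup N] [Module R N]
  {P : RootPairing ι R M N} [CharZero R] (b : P.Base) [IsDomain R] [Finite ι] [P.IsCrystallographic]

/-! ### Existence of highest roots -/

lemma add_mem_subRoots {T : Finset ι} {i j k : ι} (hi : i ∈ b.subRoots T) (hj : j ∈ b.subRoots T)
    (h : P.root k = P.root i + P.root j) : k ∈ b.subRoots T := by
  have : P.root i + P.root j ∈ Submodule.span ℤ (P.root '' (T : Set ι)) := add_mem hi hj
  rwa [← h] at this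

lemma sub_mem_subRoots {T : Finset ι} {i j k : ι} (hi : i ∈ b.subRoots T) (hj : j ∈ b.subRoots T)
    (h : P.root k = P.root i - P.root j) : k ∈ b.subRoots T := by
  have : P.root i - P.root j ∈ Submodule.span ℤ (P.root '' (T : Set ι)) := sub_mem hi hj
  rwa [← h] at this

/-- A positive root of `R_T` is weakly maximal if no simple root of `T` can be added to it. -/
structure IsWeaklyMaximal (T : Finset ι) (i : ι) : Prop where
  mem : i ∈ b.subRoots T
  isPos : b.IsPos i
  add_notMem : ∀ j ∈ T, P.root i + P.root j ∉ Set.range P.root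

variable {b}

lemma IsPos.root_ne_neg {i j : ι} (hi : b.IsPos i) (hj : b.IsPos j) : P.root i ≠ -P.root j := by
  intro h
  have := b.coeff_neg h
  have h1 := b.isPos_iff_coeff_nonneg.mp hi
  have h2 := b.isPos_iff_coeff_nonneg.mp hj
  rcases b.coeff_pos_or_neg i with h3 | h3
  · exact absurd (h3.trans_le (this.le.trans (neg_nonpos.mpr h2))) (lt_irrefl _)
  · exact absurd (h3.trans_le h1) (lt_irrefl _)

lemma IsWeaklyMaximal.pairingIn_nonneg {T : Finset ι} (hT : T ⊆ b.support) {i : ι}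
    (h : b.IsWeaklyMaximal T i) {j : ι} (hj : j ∈ T) : 0 ≤ P.pairingIn ℤ i j := by
  by_contra! hneg
  exact h.add_notMem j hj (P.root_add_root_mem_of_pairingIn_neg hneg
    (h.isPos.root_ne_neg (isPos_of_mem_support (hT hj))))

lemma IsWeaklyMaximal.pairingIn_nonneg' {T : Finset ι} (hT : T ⊆ b.support) {i : ι}
    (h : b.IsWeaklyMaximal T i) {j : ι} (hj : j ∈ T) : 0 ≤ P.pairingIn ℤ j i := by
  have := h.pairingIn_nonneg hT hj
  contrapose! this
  exact (P.pairingIn_lt_zero_iff ℤ).mp this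

/-- A weakly maximal root of a connected set `T` has full support: otherwise a simple root outside
of its support, but adjacent to it, could be added. -/
lemma IsWeaklyMaximal.coeff_pos {T : Finset ι} (hT : T ⊆ b.support) (hc : b.IsConnectedSet T)
    {i : ι} (h : b.IsWeaklyMaximal T i) {j : ι} (hj : j ∈ T) : 0 < b.coeff i j := by
  have h0 := b.isPos_iff_coeff_nonneg.mp h.isPos
  obtain ⟨a, ha, ha'⟩ : ∃ a ∈ T, 0 < b.coeff i a := by
    by_contra! hcon
    refine P.ne_zero i ?_
    rw [b.root_eq_sum_coeff i]
    refine Finset.sum_eq_zero fun k _ ↦ ?_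
    have : b.coeff i k = 0 := by
      by_cases hk : k ∈ T
      · exact le_antisymm (hcon k hk) (h0 k)
      · exact (b.mem_subRoots_iff hT).mp h.mem k hk
    rw [this, zero_smul]
  refine hc.induction b (Q := fun k ↦ 0 < b.coeff i k) ha ha' (fun k hk l hl hkpos hkl ↦ ?_) j hj
  by_contra hl0
  have hl0 : b.coeff i l = 0 := le_antisymm (not_lt.mp hl0) (h0 l)
  have hne : k ≠ l := by rintro rfl; exact hkpos.ne' hl0
  have hlt : P.pairingIn ℤ i l < 0 := by
    rw [b.pairingIn_eq_sum_coeff]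
    have hle : ∀ m ∈ b.support, b.coeff i m * P.pairingIn ℤ m l ≤ 0 := by
      intro m hm
      by_cases hml : m = l
      · rw [hml, hl0, zero_mul]
      · exact mul_nonpos_of_nonneg_of_nonpos (h0 m) (b.pairingIn_le_zero_of_ne hml hm (hT hl))
    refine Finset.sum_neg' hle ⟨k, hT hk, mul_neg_of_pos_of_neg hkpos ?_⟩
    refine lt_of_le_of_ne (b.pairingIn_le_zero_of_ne hne (hT hk) (hT hl)) ?_
    rwa [Ne, ← isOrthogonal_iff_pairingIn]
  exact absurd hlt (not_lt.mpr (h.pairingIn_nonneg hT hl))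

lemma IsWeaklyMaximal.pairingIn_pos {T : Finset ι} (hT : T ⊆ b.support) (hc : b.IsConnectedSet T)
    {i j : ι} (hi : b.IsWeaklyMaximal T i) (hj : b.IsWeaklyMaximal T j) :
    0 < P.pairingIn ℤ i j := by
  have h0 := b.isPos_iff_coeff_nonneg.mp hi.isPos
  have h0' := b.isPos_iff_coeff_nonneg.mp hj.isPos
  have hz : ∀ m : ι, m ∉ T → b.coeff i m = 0 := (b.mem_subRoots_iff hT).mp hi.mem
  have hz' : ∀ m : ι, m ∉ T → b.coeff j m = 0 := (b.mem_subRoots_iff hT).mp hj.mem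
  obtain ⟨l, hl, hlpos⟩ : ∃ l ∈ T, 0 < P.pairingIn ℤ l j := by
    by_contra! hcon
    have h2 : P.pairingIn ℤ j j ≤ 0 := by
      rw [b.pairingIn_eq_sum_coeff]
      refine Finset.sum_nonpos fun m _ ↦ ?_
      by_cases hm : m ∈ T
      · exact mul_nonpos_of_nonneg_of_nonpos (h0' m) (hcon m hm)
      · rw [hz' m hm, zero_mul]
    simp at h2
  rw [b.pairingIn_eq_sum_coeff]
  refine Finset.sum_pos' (fun m _ ↦ ?_) ⟨l, hT hl, mul_pos (hi.coeff_pos hT hc hl) hlpos⟩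
  by_cases hm : m ∈ T
  · exact mul_nonneg (h0 m) (hj.pairingIn_nonneg' hT hm)
  · rw [hz m hm, zero_mul]

lemma exists_isHighestRoot {T : Finset ι} (hT : T ⊆ b.support) (hc : b.IsConnectedSet T) :
    ∃ i, b.IsHighestRoot T i := by
  obtain ⟨a, ha⟩ := hc.nonempty
  obtain ⟨i, hi, hmax⟩ := Set.exists_max_image (b.subRoots T) b.height (Set.toFinite _)
    ⟨a, b.mem_subRoots_of_mem ha⟩
  have hipos : b.IsPos i := by
    have := hmax a (b.mem_subRoots_of_mem ha)
    rw [height_one_of_mem_support (hT ha)] at this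
    rw [isPos_iff]
    lia
  have hiw : b.IsWeaklyMaximal T i := by
    refine ⟨hi, hipos, ?_⟩
    rintro j hj ⟨k, hk⟩
    have := hmax k (b.add_mem_subRoots hi (b.mem_subRoots_of_mem hj) hk)
    rw [b.height_add hk, height_one_of_mem_support (hT hj)] at this
    lia
  refine ⟨i, (b.isHighestRoot_iff hT).mpr ⟨hi, ?_⟩⟩
  -- Downward induction on the height of `j`.
  suffices ∀ n : ℕ, ∀ j ∈ b.subRoots T, b.height i - b.height j < n → b.coeff j ≤ b.coeff i from
    fun j hj ↦ this ((b.height i - b.height j).toNat + 1) j hj (by lia)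
  intro n
  induction n with
  | zero =>
    intro j hj hlt
    have := hmax j hj
    lia
  | succ n ih =>
    intro j hj hlt
    by_cases hadd : ∃ l ∈ T, P.root j + P.root l ∈ Set.range P.root
    · obtain ⟨l, hl, k, hk⟩ := hadd
      have hkT := b.add_mem_subRoots hj (b.mem_subRoots_of_mem hl) hk
      refine le_trans ?_ (ih k hkT ?_)
      · rw [b.coeff_add hk]
        exact le_add_of_nonneg_right
          (b.isPos_iff_coeff_nonneg.mp (isPos_of_mem_support (hT hl)))
      · rw [b.height_add hk, height_one_of_mem_support (hT hl)]
        lia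
    · push Not at hadd
      have hi0 := b.isPos_iff_coeff_nonneg.mp hipos
      rcases b.coeff_pos_or_neg j with hj0 | hj0
      · have hjw : b.IsWeaklyMaximal T j := ⟨hj, b.isPos_iff_coeff_nonneg.mpr hj0.le, hadd⟩
        rcases eq_or_ne i j with rfl | hij
        · exact le_rfl
        obtain ⟨k, hk⟩ := P.root_sub_root_mem_of_pairingIn_pos (hiw.pairingIn_pos hT hc hjw) hij
        have hkpos : b.IsPos k := by
          rw [isPos_iff', b.height_sub hk]
          have := hmax j hj
          lia
        have := b.isPos_iff_coeff_nonneg.mp hkpos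
        rwa [b.coeff_sub hk, sub_nonneg] at this
      · exact hj0.le.trans hi0

lemma isHighestRoot_highestRoot [Nonempty ι] {T : Finset ι} (hT : T ⊆ b.support)
    (hc : b.IsConnectedSet T) : b.IsHighestRoot T (b.highestRoot T) :=
  Classical.epsilon_spec (exists_isHighestRoot hT hc)

section HighestRoot

variable [Nonempty ι] {T : Finset ι} (hT : T ⊆ b.support) (hc : b.IsConnectedSet T)

include hT hc

lemma highestRoot_mem_subRoots : b.highestRoot T ∈ b.subRoots T :=
  (isHighestRoot_highestRoot hT hc).1

lemma coeff_le_coeff_highestRoot {j : ι} (hj : j ∈ b.subRoots T) :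
    b.coeff j ≤ b.coeff (b.highestRoot T) :=
  ((b.isHighestRoot_iff hT).mp (isHighestRoot_highestRoot hT hc)).2 j hj

lemma coeff_highestRoot_pos {j : ι} (hj : j ∈ T) : 0 < b.coeff (b.highestRoot T) j := by
  classical
  have := coeff_le_coeff_highestRoot hT hc (b.mem_subRoots_of_mem hj) j
  rw [b.coeff_self (hT hj), Pi.single_eq_same] at this
  lia

lemma isPos_highestRoot : b.IsPos (b.highestRoot T) := by
  obtain ⟨a, ha⟩ := hc.nonempty
  exact b.isPos_of_coeff_pos (coeff_highestRoot_pos hT hc ha)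

/-- The sum of the highest root and of a positive root of `R_T` is not a root. -/
lemma highestRoot_add_notMem {j : ι} (hj : j ∈ b.subRoots T) (hpos : b.IsPos j) :
    P.root (b.highestRoot T) + P.root j ∉ Set.range P.root := by
  rintro ⟨k, hk⟩
  have hle := coeff_le_coeff_highestRoot hT hc
    (b.add_mem_subRoots (highestRoot_mem_subRoots hT hc) hj hk)
  rw [b.coeff_add hk] at hle
  have h0 : b.coeff j = 0 := le_antisymm (by simpa using hle) (b.isPos_iff_coeff_nonneg.mp hpos)
  refine P.ne_zero j ?_
  rw [b.root_eq_sum_coeff j, h0]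
  simp

lemma isWeaklyMaximal_highestRoot : b.IsWeaklyMaximal T (b.highestRoot T) :=
  ⟨highestRoot_mem_subRoots hT hc, isPos_highestRoot hT hc, fun _ hj ↦
    highestRoot_add_notMem hT hc (b.mem_subRoots_of_mem hj) (isPos_of_mem_support (hT hj))⟩

/-- A positive root of `R_T` orthogonal to the highest root is a combination of simple roots
orthogonal to the highest root, because the highest root is dominant. -/
lemma isOrthogonal_of_isOrthogonal_highestRoot {i : ι} (hi : i ∈ b.subRoots T) (hpos : b.IsPos i)
    (h : P.IsOrthogonal i (b.highestRoot T)) {j : ι} (hj : b.coeff i j ≠ 0) :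
    P.IsOrthogonal j (b.highestRoot T) := by
  have hz := (b.mem_subRoots_iff hT).mp hi
  have h0 := b.isPos_iff_coeff_nonneg.mp hpos
  rw [isOrthogonal_iff_pairingIn, b.pairingIn_eq_sum_coeff, Finset.sum_eq_zero_iff_of_nonneg] at h
  · have hjT : j ∈ T := by
      by_contra hjT
      exact hj (hz j hjT)
    rw [isOrthogonal_iff_pairingIn]
    exact (mul_eq_zero.mp (h j (hT hjT))).resolve_left hj
  · intro m _
    by_cases hm : m ∈ T
    · exact mul_nonneg (h0 m) ((isWeaklyMaximal_highestRoot hT hc).pairingIn_nonneg' hT hm)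
    · rw [hz m hm, zero_mul]

open Classical in
lemma card_filter_isOrthogonal_lt :
    Finset.card {i ∈ T | P.IsOrthogonal i (b.highestRoot T)} < T.card := by
  refine Finset.card_lt_card (Finset.filter_ssubset.mpr ?_)
  by_contra! hcon
  have h2 : P.pairingIn ℤ (b.highestRoot T) (b.highestRoot T) = 0 := by
    rw [b.pairingIn_eq_sum_coeff]
    refine Finset.sum_eq_zero fun m _ ↦ ?_
    by_cases hm : m ∈ T
    · rw [isOrthogonal_iff_pairingIn.mp (hcon m hm), mul_zero]
    · rw [(b.mem_subRoots_iff hT).mp (highestRoot_mem_subRoots hT hc) m hm, zero_mul]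
  simp at h2

end HighestRoot

/-! ### Supports and connected components -/

variable (b) in
open Classical in
/-- The support of a root: the simple roots occurring in it. -/
def rootSupport (i : ι) : Finset ι := {j ∈ b.support | b.coeff i j ≠ 0}

lemma mem_rootSupport {i j : ι} : j ∈ b.rootSupport i ↔ b.coeff i j ≠ 0 := by
  rw [rootSupport, Finset.mem_filter, and_iff_right_iff_imp]
  intro h
  by_contra hj
  exact h (b.coeff_eq_zero_of_notMem i hj)

lemma rootSupport_subset_iff {T : Finset ι} (hT : T ⊆ b.support) {i : ι} :
    b.rootSupport i ⊆ T ↔ i ∈ b.subRoots T := by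
  rw [b.mem_subRoots_iff hT]
  refine forall_congr' fun j ↦ ?_
  rw [mem_rootSupport, not_imp_comm]

lemma root_add_root_mem_comm_of_isOrthogonal {i j : ι} (h : P.IsOrthogonal i j) :
    P.root i - P.root j ∈ Set.range P.root ↔ P.root i + P.root j ∈ Set.range P.root := by
  have h1 : P.reflection j (P.root i) = P.root i := by
    rw [P.reflection_apply_root, h.1, zero_smul, sub_zero]
  have key : P.reflection j (P.root i + P.root j) = P.root i - P.root j := by
    rw [map_add, h1, P.reflection_apply_self, sub_eq_add_neg]
  constructor
  · rintro ⟨k, hk⟩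
    refine ⟨P.reflectionPerm j k, ?_⟩
    rw [P.root_reflectionPerm, hk, ← key]
    simp
  · rintro ⟨k, hk⟩
    exact ⟨P.reflectionPerm j k, by rw [P.root_reflectionPerm, hk, key]⟩

lemma exists_coeff_ne_zero (i : ι) : ∃ j, b.coeff i j ≠ 0 := by
  by_contra! h
  exact P.ne_zero i (by rw [b.root_eq_sum_coeff i]; simp [h])

/-- If a simple root outside of the support of a positive root can be added to it, then it is
adjacent to the support: otherwise it could also be subtracted. -/
lemma exists_not_isOrthogonal_of_add_mem {i j : ι} (hi : b.IsPos i) (hj : j ∈ b.support)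
    (hij : b.coeff i j = 0) (h : P.root i + P.root j ∈ Set.range P.root) :
    ∃ l ∈ b.rootSupport i, ¬ P.IsOrthogonal l j := by
  classical
  by_contra! hcon
  have hort : P.IsOrthogonal i j := by
    rw [isOrthogonal_iff_pairingIn, b.pairingIn_eq_sum_coeff]
    refine Finset.sum_eq_zero fun m _ ↦ ?_
    by_cases hm : b.coeff i m = 0
    · rw [hm, zero_mul]
    · rw [isOrthogonal_iff_pairingIn.mp (hcon m (mem_rootSupport.mpr hm)), mul_zero]
  obtain ⟨k, hk⟩ := (root_add_root_mem_comm_of_isOrthogonal hort).mpr h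
  have hkc := b.coeff_sub hk
  rw [b.coeff_self hj] at hkc
  obtain ⟨m, hm⟩ := b.exists_coeff_ne_zero i
  have hmj : m ≠ j := by rintro rfl; exact hm hij
  have h0 := b.isPos_iff_coeff_nonneg.mp hi
  rcases b.coeff_pos_or_neg k with hk0 | hk0
  · have := hk0.le j
    rw [hkc] at this
    simp [hij] at this
  · have h1 := hk0.le m
    have h2 := h0 m
    rw [hkc] at h1
    simp [hmj] at h1 h2
    exact hm (le_antisymm h1 h2)

lemma isConnectedSet_rootSupport {i : ι} (hi : b.IsPos i) : b.IsConnectedSet (b.rootSupport i) := by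
  classical
  refine (hi.induction_on_add (p := fun i ↦ b.IsPos i ∧ b.IsConnectedSet (b.rootSupport i))
    (fun i hi ↦ ⟨isPos_of_mem_support hi, ?_⟩) (fun i j k h ⟨hi, ih⟩ hj ↦ ⟨?_, ?_⟩)).2
  · convert b.isConnectedSet_singleton i
    ext j
    rw [mem_rootSupport, b.coeff_self hi, Pi.single_apply]
    simp
  · exact hi.add (isPos_of_mem_support hj) h
  · have hk : b.rootSupport k = b.rootSupport i ∪ {j} := by
      ext m
      have h0 := b.isPos_iff_coeff_nonneg.mp hi m
      rw [Finset.mem_union, mem_rootSupport, mem_rootSupport, b.coeff_add h, b.coeff_self hj,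
        Finset.mem_singleton, Pi.add_apply, Pi.single_apply]
      simp only [Pi.zero_apply] at h0
      split_ifs with hm <;> simp only [hm, iff_true, or_true, or_false, add_zero]
      subst hm
      lia
    by_cases hij : b.coeff i j = 0
    · obtain ⟨l, hl, hlj⟩ := exists_not_isOrthogonal_of_add_mem hi hj hij ⟨k, h⟩
      rw [hk]
      exact ih.union b (b.isConnectedSet_singleton j) hl (Finset.mem_singleton_self j) hlj
    · rwa [hk, Finset.union_eq_left.mpr]
      simpa [mem_rootSupport] using hij

lemma exists_isComponent {T D : Finset ι} (hD : D ⊆ T) (hc : b.IsConnectedSet D) :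
    ∃ C, b.IsComponent T C ∧ D ⊆ C := by
  obtain ⟨C, hDC, hC⟩ := Set.Finite.exists_le_maximal (s := {D | D ⊆ T ∧ b.IsConnectedSet D})
    (Set.toFinite _) ⟨hD, hc⟩
  exact ⟨C, hC, hDC⟩

lemma IsConnectedSet.isComponent_self {T : Finset ι} (hc : b.IsConnectedSet T) :
    b.IsComponent T T :=
  ⟨⟨subset_rfl, hc⟩, fun _ h _ ↦ h.1⟩

/-- Distinct components are orthogonal to each other. -/
lemma IsComponent.eq_of_not_isOrthogonal {T C D : Finset ι} (hC : b.IsComponent T C)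
    (hD : b.IsComponent T D) {i j : ι} (hi : i ∈ C) (hj : j ∈ D) (hij : ¬ P.IsOrthogonal i j) :
    C = D := by
  classical
  have h : C ∪ D ⊆ T ∧ b.IsConnectedSet (C ∪ D) :=
    ⟨Finset.union_subset hC.prop.1 hD.prop.1, hC.prop.2.union b hD.prop.2 hi hj hij⟩
  exact (hC.eq_of_le h Finset.subset_union_left).trans
    (hD.eq_of_le h Finset.subset_union_right).symm

lemma not_isOrthogonal_self (i : ι) : ¬ P.IsOrthogonal i i := by
  rw [isOrthogonal_iff_pairingIn]
  simp

lemma IsComponent.eq_of_mem {T C D : Finset ι} (hC : b.IsComponent T C)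
    (hD : b.IsComponent T D) {i : ι} (hi : i ∈ C) (hj : i ∈ D) : C = D :=
  hC.eq_of_not_isOrthogonal hD hi hj (not_isOrthogonal_self i)

/-! ### The cascade -/

section Cascade

variable [Nonempty ι]

open Classical in
lemma Cascade.exists_isComponent {T K : Finset ι} (h : b.Cascade T K) :
    ∃ C, b.IsComponent T C ∧
      (K = C ∨ b.Cascade {i ∈ C | P.IsOrthogonal i (b.highestRoot C)} K) := by
  induction h with
  | component hC _ ih =>
    obtain ⟨C', hC', h⟩ := ih
    obtain rfl := hC'.eq_of_le ⟨subset_rfl, hC.prop.2⟩ hC'.prop.1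
    exact ⟨_, hC, h⟩
  | self hT => exact ⟨_, hT.isComponent_self, .inl rfl⟩
  | orthogonal hT hK _ => exact ⟨_, hT.isComponent_self, .inr hK⟩

lemma Cascade.subset {T K : Finset ι} (h : b.Cascade T K) : K ⊆ T := by
  classical
  induction h with
  | component hC _ ih => exact ih.trans hC.prop.1
  | self hT => exact subset_rfl
  | orthogonal hT hK ih => exact ih.trans (Finset.filter_subset _ _)

lemma Cascade.isConnectedSet {T K : Finset ι} (h : b.Cascade T K) : b.IsConnectedSet K := by
  classical
  induction h with
  | component hC _ ih => exact ih
  | self hT => exact hT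
  | orthogonal hT hK ih => exact ih

/-- Every positive root of `R_T` belongs to some `Γ^K` with `K` in the cascade of `T`. -/
lemma exists_cascade_mem_cascadeGamma [P.IsReduced] {T : Finset ι} (hT : T ⊆ b.support) {i : ι}
    (hi : b.IsPos i) (hiT : i ∈ b.subRoots T) : ∃ K, b.Cascade T K ∧ i ∈ b.cascadeGamma K := by
  classical
  induction hn : T.card using Nat.strong_induction_on generalizing T with
  | _ n ih =>
    obtain ⟨C, hC, hiC⟩ := exists_isComponent ((rootSupport_subset_iff hT).mpr hiT)
      (isConnectedSet_rootSupport hi)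
    have hCT := hC.prop.1.trans hT
    rw [rootSupport_subset_iff hCT] at hiC
    by_cases hort : P.IsOrthogonal i (b.highestRoot C)
    · have hlt := (card_filter_isOrthogonal_lt hCT hC.prop.2).trans_le
        (Finset.card_le_card hC.prop.1)
      have hsub : {j ∈ C | P.IsOrthogonal j (b.highestRoot C)} ⊆ b.support :=
        (Finset.filter_subset _ _).trans hCT
      obtain ⟨K, hK, hiK⟩ := ih _ (hn ▸ hlt) hsub (by
        rw [← rootSupport_subset_iff hsub]
        intro j hj
        refine Finset.mem_filter.mpr ⟨(rootSupport_subset_iff hCT).mpr hiC hj, ?_⟩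
        exact isOrthogonal_of_isOrthogonal_highestRoot hCT hC.prop.2 hiC hi hort
          (mem_rootSupport.mp hj)) rfl
      exact ⟨K, .component hC (.orthogonal hC.prop.2 hK), hiK⟩
    · exact ⟨C, .component hC (.self hC.prop.2), hi, hiC, hort⟩

/-- Two roots are strongly orthogonal if they are orthogonal and neither their sum nor their
difference is a root. -/
def _root_.RootPairing.IsStronglyOrthogonal (P : RootPairing ι R M N) (i j : ι) : Prop :=
  P.IsOrthogonal i j ∧ P.root i + P.root j ∉ Set.range P.root ∧
    P.root i - P.root j ∉ Set.range P.root

lemma isStronglyOrthogonal_of_add_notMem {i j : ι} (h : P.IsOrthogonal i j)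
    (h' : P.root i + P.root j ∉ Set.range P.root) : P.IsStronglyOrthogonal i j :=
  ⟨h, h', by rwa [root_add_root_mem_comm_of_isOrthogonal h]⟩

lemma _root_.RootPairing.IsStronglyOrthogonal.symm {i j : ι} (h : P.IsStronglyOrthogonal i j) :
    P.IsStronglyOrthogonal j i :=
  isStronglyOrthogonal_of_add_notMem ((P.isOrthogonal_symm _ _).mp h.1)
    (by rw [add_comm]; exact h.2.1)

lemma isOrthogonal_of_forall_coeff {i j : ι} (h : ∀ k, b.coeff i k ≠ 0 → P.IsOrthogonal k j) :
    P.IsOrthogonal i j := by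
  rw [isOrthogonal_iff_pairingIn, b.pairingIn_eq_sum_coeff]
  refine Finset.sum_eq_zero fun m _ ↦ ?_
  by_cases hm : b.coeff i m = 0
  · rw [hm, zero_mul]
  · rw [isOrthogonal_iff_pairingIn.mp (h m hm), mul_zero]

/-- The highest root of a connected set `C` is strongly orthogonal to the positive roots supported
in `{α ∈ C ; α ⊥ ε_C}`. -/
lemma isStronglyOrthogonal_highestRoot {C : Finset ι} (hC : C ⊆ b.support)
    (hc : b.IsConnectedSet C) {i : ι} (hpos : b.IsPos i)
    (hi : ∀ k, b.coeff i k ≠ 0 → k ∈ C ∧ P.IsOrthogonal k (b.highestRoot C)) :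
    P.IsStronglyOrthogonal (b.highestRoot C) i := by
  refine isStronglyOrthogonal_of_add_notMem ?_ ?_
  · exact (P.isOrthogonal_symm _ _).mp (isOrthogonal_of_forall_coeff fun k hk ↦ (hi k hk).2)
  · refine highestRoot_add_notMem hC hc ?_ hpos
    rw [b.mem_subRoots_iff hC]
    intro j hj
    by_contra h
    exact hj (hi j h).1

/-- Positive roots supported in distinct components are strongly orthogonal. -/
lemma IsComponent.isStronglyOrthogonal {T C D : Finset ι} (hT : T ⊆ b.support)
    (hC : b.IsComponent T C) (hD : b.IsComponent T D) (hCD : C ≠ D) {i j : ι} (hi : b.IsPos i)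
    (hj : b.IsPos j) (hiC : i ∈ b.subRoots C) (hjD : j ∈ b.subRoots D) :
    P.IsStronglyOrthogonal i j := by
  have hiC' := (b.mem_subRoots_iff (hC.prop.1.trans hT)).mp hiC
  have hjD' := (b.mem_subRoots_iff (hD.prop.1.trans hT)).mp hjD
  have memC : ∀ k, b.coeff i k ≠ 0 → k ∈ C := fun k hk ↦ not_imp_comm.mp (hiC' k) hk
  have memD : ∀ k, b.coeff j k ≠ 0 → k ∈ D := fun k hk ↦ not_imp_comm.mp (hjD' k) hk
  have hort : ∀ k ∈ C, ∀ l ∈ D, P.IsOrthogonal k l := by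
    intro k hk l hl
    by_contra h
    exact hCD (hC.eq_of_not_isOrthogonal hD hk hl h)
  refine isStronglyOrthogonal_of_add_notMem ?_ ?_
  · refine isOrthogonal_of_forall_coeff (b := b) fun k hk ↦ (P.isOrthogonal_symm _ _).mp
      (isOrthogonal_of_forall_coeff (b := b) fun l hl ↦ (P.isOrthogonal_symm _ _).mp
        (hort k (memC k hk) l (memD l hl)))
  · rintro ⟨k, hk⟩
    have hi0 := b.isPos_iff_coeff_nonneg.mp hi
    have hj0 := b.isPos_iff_coeff_nonneg.mp hj
    have hkc := b.coeff_add hk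
    have hle : ∀ m, b.coeff k m = b.coeff i m + b.coeff j m := fun m ↦ congr_fun hkc m
    obtain ⟨E, hE, hkE⟩ := exists_isComponent (b := b) (T := T) (D := b.rootSupport k) (by
      intro m hm
      rw [mem_rootSupport, hle] at hm
      by_cases h0 : b.coeff i m = 0
      · exact hD.prop.1 (memD m fun h ↦ hm (by rw [h0, h, add_zero]))
      · exact hC.prop.1 (memC m h0)) (isConnectedSet_rootSupport (hi.add hj hk))
    obtain ⟨m, hm⟩ := b.exists_coeff_ne_zero i
    obtain ⟨l, hl⟩ := b.exists_coeff_ne_zero j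
    have hmE : m ∈ E := hkE (mem_rootSupport.mpr (by
      have h1 := hi0 m
      have h2 := hj0 m
      simp only [Pi.zero_apply] at h1 h2
      rw [hle]
      lia))
    have hlE : l ∈ E := hkE (mem_rootSupport.mpr (by
      have h1 := hi0 l
      have h2 := hj0 l
      simp only [Pi.zero_apply] at h1 h2
      rw [hle]
      lia))
    exact hCD ((hC.eq_of_mem hE (memC m hm) hmE).trans (hD.eq_of_mem hE (memD l hl) hlE).symm)

/-- The highest roots of the members of a cascade are pairwise strongly orthogonal. -/
lemma Cascade.isStronglyOrthogonal {T K K' : Finset ι} (hT : T ⊆ b.support)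
    (hK : b.Cascade T K) (hK' : b.Cascade T K') (hne : K ≠ K') :
    P.IsStronglyOrthogonal (b.highestRoot K) (b.highestRoot K') := by
  classical
  induction hn : T.card using Nat.strong_induction_on generalizing T with
  | _ n ih =>
    have hKs := hK.subset.trans hT
    have hKs' := hK'.subset.trans hT
    have hKc := hK.isConnectedSet
    have hKc' := hK'.isConnectedSet
    obtain ⟨C, hC, h⟩ := hK.exists_isComponent
    obtain ⟨C', hC', h'⟩ := hK'.exists_isComponent
    have hCs := hC.prop.1.trans hT
    by_cases hCC : C = C'
    · subst hCC
      have aux : ∀ K, b.Cascade {i ∈ C | P.IsOrthogonal i (b.highestRoot C)} K →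
          P.IsStronglyOrthogonal (b.highestRoot C) (b.highestRoot K) := by
        intro K h
        have hsub := h.subset
        have hKs := hsub.trans ((Finset.filter_subset _ _).trans hCs)
        refine isStronglyOrthogonal_highestRoot hCs hC.prop.2
          (isPos_highestRoot hKs h.isConnectedSet) fun k hk ↦ ?_
        have := (rootSupport_subset_iff hKs).mpr (highestRoot_mem_subRoots hKs h.isConnectedSet)
        exact Finset.mem_filter.mp (hsub (this (mem_rootSupport.mpr hk)))
      rcases h with rfl | h <;> rcases h' with rfl | h'
      · exact absurd rfl hne
      · exact aux _ h'
      · exact (aux _ h).symm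
      · refine ih _ ?_ ((Finset.filter_subset _ _).trans hCs) h h' rfl
        exact hn ▸ (card_filter_isOrthogonal_lt hCs hC.prop.2).trans_le
          (Finset.card_le_card hC.prop.1)
    · have key : ∀ C K, b.IsComponent T C → b.Cascade T K → (K = C ∨
          b.Cascade {i ∈ C | P.IsOrthogonal i (b.highestRoot C)} K) →
          b.highestRoot K ∈ b.subRoots C := by
        intro C K hC hK h
        have hKC : K ⊆ C := by
          rcases h with rfl | h
          · exact subset_rfl
          · exact h.subset.trans (Finset.filter_subset _ _)
        rw [← rootSupport_subset_iff (hC.prop.1.trans hT)]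
        exact ((rootSupport_subset_iff (hK.subset.trans hT)).mpr
          (highestRoot_mem_subRoots (hK.subset.trans hT) hK.isConnectedSet)).trans hKC
      exact hC.isStronglyOrthogonal hT hC' hCC (isPos_highestRoot hKs hKc)
        (isPos_highestRoot hKs' hKc') (key C K hC hK h) (key C' K' hC' hK' h')

end Cascade

end RootPairing.Base

/-! ### Semisimple endomorphisms -/

namespace Module.End

variable {K V : Type*} [Field K] [AddCommGroup V] [Module K V] [FiniteDimensional K V]

lemma IsSemisimple.isCompl_ker_range {f : Module.End K V} (hf : f.IsSemisimple) :
    IsCompl (LinearMap.ker f) (LinearMap.range f) := by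
  have hinv : LinearMap.ker f ∈ f.invtSubmodule := by
    intro x hx
    simpa using congr_arg f hx
  obtain ⟨q, hq, hc⟩ := isSemisimple_iff.mp hf _ hinv
  have hle : LinearMap.range f ≤ q := by
    rintro _ ⟨x, rfl⟩
    obtain ⟨u, hu, v, hv, rfl⟩ := Submodule.mem_sup.mp
      (hc.sup_eq_top ▸ Submodule.mem_top : x ∈ LinearMap.ker f ⊔ q)
    rw [map_add, LinearMap.mem_ker.mp hu, zero_add]
    exact hq hv
  have : LinearMap.range f = q := by
    refine Submodule.eq_of_le_of_finrank_eq hle ?_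
    have h1 := Submodule.finrank_add_eq_of_isCompl hc
    have h2 := LinearMap.finrank_range_add_finrank_ker f
    lia
  rwa [this]

/-- For commuting endomorphisms `f` and `g`, with `f` semisimple, the kernel of a generic
combination `f + t • g` is contained in the kernels of `f` and `g`: `-t` should not be the quotient
of a non-zero eigenvalue of `f` by an eigenvalue of `g`. -/
lemma IsSemisimple.exists_ker_add_smul_le [IsAlgClosed K] {f g : Module.End K V}
    (hf : f.IsSemisimple) (hfg : Commute f g) :
    ∃ t : K, LinearMap.ker (f + t • g) ≤ LinearMap.ker f ⊓ LinearMap.ker g := by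
  have : Infinite K := IsAlgClosed.instInfinite
  have hfin : (insert 0 ((fun x : K × K ↦ -x.1 / x.2) ''
      ({μ | f.HasEigenvalue μ} ×ˢ {μ | g.HasEigenvalue μ}))).Finite :=
    ((f.finite_hasEigenvalue.prod g.finite_hasEigenvalue).image _).insert 0
  obtain ⟨t, ht⟩ := hfin.infinite_compl.nonempty
  rw [Set.mem_compl_iff, Set.mem_insert_iff, not_or] at ht
  obtain ⟨ht0, ht⟩ := ht
  refine ⟨t, ?_⟩
  set W := LinearMap.ker (f + t • g) with hW
  have hgW : ∀ {v}, v ∈ W → f v = -(t • g v) := fun {v} hv ↦ by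
    rw [hW, LinearMap.mem_ker, LinearMap.add_apply, LinearMap.smul_apply] at hv
    exact eq_neg_of_add_eq_zero_left hv
  have hWinv : ∀ v ∈ W, f v ∈ W := by
    intro v hv
    rw [hW, LinearMap.mem_ker]
    have : Commute f (f + t • g) := (Commute.refl f).add_right (hfg.smul_right t)
    have h2 := LinearMap.congr_fun this.eq v
    rw [Module.End.mul_apply, Module.End.mul_apply, LinearMap.mem_ker.mp hv, map_zero] at h2
    exact h2.symm
  have hfW : Module.End.IsSemisimple (LinearMap.restrict f hWinv) := hf.restrict hWinv
  have hzero : LinearMap.restrict f hWinv = 0 := by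
    rw [← LinearMap.ker_eq_top, eq_top_iff,
      ← iSup_maxGenEigenspace_eq_top (K := K) (LinearMap.restrict f hWinv), iSup_le_iff]
    intro μ v hv
    rw [hfW.isFinitelySemisimple.maxGenEigenspace_eq_eigenspace, mem_eigenspace_iff] at hv
    by_cases hv0 : v = 0
    · simp [hv0]
    by_cases hμ : μ = 0
    · simpa [hμ] using hv
    exfalso
    have hv' : f v = μ • (v : V) := congr_arg Subtype.val hv
    have hv0' : (v : V) ≠ 0 := by simpa using hv0
    refine ht ⟨(μ, -μ / t), ⟨hasEigenvalue_of_hasEigenvector ⟨mem_eigenspace_iff.mpr hv', hv0'⟩,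
      hasEigenvalue_of_hasEigenvector ⟨mem_eigenspace_iff.mpr ?_, hv0'⟩⟩, ?_⟩
    · have := hgW v.2
      rw [hv'] at this
      rw [div_eq_inv_mul, mul_smul, neg_smul, this, neg_neg, smul_smul, inv_mul_cancel₀ ht0,
        one_smul]
    · field_simp
  have hfv : ∀ v ∈ W, f v = 0 := fun v hv ↦
    congr_arg Subtype.val (LinearMap.congr_fun hzero ⟨v, hv⟩)
  intro v hv
  refine ⟨hfv v hv, ?_⟩
  have := hgW hv
  rw [hfv v hv, eq_comm, neg_eq_zero, smul_eq_zero] at this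
  exact this.resolve_left ht0

end Module.End

/-! ### The Jordan decomposition -/

namespace LieAlgebra.IsKilling

variable {K L : Type*} [Field K] [CharZero K] [IsAlgClosed K] [LieRing L] [LieAlgebra K L]
  [FiniteDimensional K L] [IsKilling K L]

lemma ad_injective {x y : L} (h : ad K L x = ad K L y) : x = y := by
  rw [← sub_eq_zero, ← LieDerivation.IsKilling.ad_apply_eq_zero_iff (R := K)]
  ext z
  simpa [sub_eq_zero] using LinearMap.congr_fun h z

open Module.End in
/-- The abstract Jordan decomposition: the semisimple part of `ad y` acts by scalars on the
generalized eigenspaces of `ad y`, hence is a derivation, hence is inner. -/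
lemma exists_jordan_decomposition (y : L) : ∃ s n : L, y = n + s ∧ (ad K L s).IsSemisimple ∧
    _root_.IsNilpotent (ad K L n) ∧ ad K L s ∈ Algebra.adjoin K {ad K L y} := by
  obtain ⟨N, -, S, hS₀, hN, hS, hSN⟩ := (ad K L y).exists_isNilpotent_isSemisimple
  have hSc : Commute (ad K L y) S := Algebra.commute_of_mem_adjoin_self hS₀
  rw [eq_sub_of_add_eq hSN.symm] at hN
  have aux {μ : K} {z : L} (hz : z ∈ (ad K L y).maxGenEigenspace μ) : S z = μ • z := by
    rw [maxGenEigenspace_eq] at hz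
    rw [apply_eq_of_mem_of_comm_of_isFinitelySemisimple_of_isNil hz hSc hS.isFinitelySemisimple hN]
  have htop : ∀ z : L, z ∈ ⨆ μ : K, (ad K L y).maxGenEigenspace μ := fun z ↦ by
    rw [iSup_maxGenEigenspace_eq_top]; trivial
  have h_der (u v : L) : S ⁅u, v⁆ = ⁅S u, v⁆ + ⁅u, S v⁆ := by
    induction htop u using Submodule.iSup_induction' with
    | mem μ u hu =>
      induction htop v using Submodule.iSup_induction' with
      | mem ν v hv =>
        have huv : ⁅u, v⁆ ∈ (ad K L y).maxGenEigenspace (μ + ν) :=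
          LieModule.lie_mem_maxGenEigenspace_toEnd hu hv
        rw [aux hu, aux hv, aux huv, smul_lie, lie_smul, ← add_smul]
      | zero => simp
      | add _ _ _ _ h h' => simp only [lie_add, map_add, h, h']; abel
    | zero => simp
    | add _ _ _ _ h h' => simp only [add_lie, map_add, h, h']; abel
  replace h_der : ∀ y z : L, S ⁅y, z⁆ = ⁅y, S z⁆ - ⁅z, S y⁆ := by
    simp_rw [← lie_skew (S _) _, add_comm, ← sub_eq_add_neg] at h_der; assumption
  obtain ⟨s, hs⟩ := LieDerivation.IsKilling.exists_eq_ad (⟨S, h_der⟩ : LieDerivation K L L)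
  have hs' : ad K L s = S := by rw [← LieDerivation.coe_ad_apply_eq_ad_apply s, hs]
  refine ⟨s, y - s, by abel, hs' ▸ hS, ?_, hs' ▸ hS₀⟩
  rw [map_sub, hs']
  exact hN

end LieAlgebra.IsKilling

/-! ### Centralizers of Cartan subspaces -/

namespace SymmetricPair

open LieAlgebra

variable {L : Type*} [LieRing L] [LieAlgebra ℂ L]

lemma commute_ad {x y : L} (h : ⁅x, y⁆ = 0) : Commute (ad ℂ L x) (ad ℂ L y) := by
  ext z
  simp [leibniz_lie x y z, h]

lemma isSemisimple_ad_map (e : L ≃ₗ⁅ℂ⁆ L) {x : L} (hx : (ad ℂ L x).IsSemisimple) :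
    (ad ℂ L (e x)).IsSemisimple := by
  refine (LinearEquiv.isSemisimple_iff _ _ e.toLinearEquiv ?_).mp hx
  ext z
  exact LieEquiv.map_lie e x z

variable [FiniteDimensional ℂ L]

lemma killingForm_eq_zero_of_isNilpotent {n c : L} (hn : IsNilpotent (ad ℂ L n))
    (h : ⁅n, c⁆ = 0) : killingForm ℂ L n c = 0 := by
  rw [killingForm_apply_apply, ← Module.End.mul_eq_comp]
  exact (LinearMap.isNilpotent_trace_of_isNilpotent
    ((commute_ad h).isNilpotent_mul_right hn)).eq_zero

/-- An abelian space of semisimple elements contains elements whose centralizer is the centralizer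
of the whole space. -/
lemma exists_forall_lie_eq_zero {a : Submodule ℂ L} (hab : ∀ x ∈ a, ∀ y ∈ a, ⁅x, y⁆ = 0)
    (hss : ∀ x ∈ a, (ad ℂ L x).IsSemisimple) :
    ∃ x ∈ a, ∀ z : L, ⁅x, z⁆ = 0 → ∀ c ∈ a, ⁅c, z⁆ = 0 := by
  obtain ⟨x, hx, hmin⟩ := exists_minimalFor_of_wellFoundedLT (fun x ↦ x ∈ a)
    (fun x ↦ Module.finrank ℂ (LinearMap.ker (ad ℂ L x))) ⟨0, a.zero_mem⟩
  refine ⟨x, hx, fun z hz c hc ↦ ?_⟩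
  obtain ⟨t, ht⟩ := (hss x hx).exists_ker_add_smul_le (commute_ad (hab x hx c hc))
  rw [← map_smul, ← map_add, le_inf_iff] at ht
  have hle := hmin (a.add_mem hx (a.smul_mem t hc)) (Submodule.finrank_mono ht.1)
  have heq := Submodule.eq_of_le_of_finrank_le ht.1 hle
  exact ht.2 (heq.symm ▸ (show z ∈ LinearMap.ker (ad ℂ L x) from hz))

variable {θ : L ≃ₗ⁅ℂ⁆ L} (hθ : ∀ x, θ (θ x) = x) {k p : Submodule ℂ L}
  (hk : ∀ x, x ∈ k ↔ θ x = x) (hp : ∀ x, x ∈ p ↔ θ x = -x)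

include hθ

include hk in
lemma add_map_mem (x : L) : x + θ x ∈ k := by
  rw [hk, map_add, hθ, add_comm]

include hp in
lemma sub_map_mem (x : L) : x - θ x ∈ p := by
  rw [hp, map_sub, hθ, neg_sub]

include hp

lemma lie_sub_map_eq_zero {x : L} (hx : x ∈ p) {u : L} (hu : ⁅x, u⁆ = 0) : ⁅x, u - θ u⁆ = 0 := by
  have : ⁅θ x, θ u⁆ = 0 := by rw [← LieEquiv.map_lie, hu, map_zero]
  rw [(hp x).mp hx, neg_lie, neg_eq_zero] at this
  rw [lie_sub, hu, this, sub_zero]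

variable [IsKilling ℂ L]

/-- The Killing form is non-degenerate on the centralizer in `p` of a semisimple element of `p`. -/
lemma eq_zero_of_forall_killingForm {x : L} (hx : x ∈ p) (hss : (ad ℂ L x).IsSemisimple) {y : L}
    (hy : y ∈ p) (hxy : ⁅x, y⁆ = 0) (h : ∀ z ∈ p, ⁅x, z⁆ = 0 → killingForm ℂ L y z = 0) :
    y = 0 := by
  refine (IsKilling.killingForm_nondegenerate ℂ L).1 y fun z ↦ ?_
  obtain ⟨u, hu, v, ⟨w, rfl⟩, rfl⟩ := Submodule.mem_sup.mp
    (hss.isCompl_ker_range.sup_eq_top ▸ Submodule.mem_top :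
      z ∈ LinearMap.ker (ad ℂ L x) ⊔ LinearMap.range (ad ℂ L x))
  have hu : ⁅x, u⁆ = 0 := hu
  have h1 : killingForm ℂ L y ⁅x, w⁆ = 0 := by
    have hyx : ⁅y, x⁆ = 0 := by rw [← lie_skew, hxy, neg_zero]
    rw [← LieModule.traceForm_apply_lie_apply, hyx, map_zero, LinearMap.zero_apply]
  have h2 := h (u - θ u) (sub_map_mem hθ hp u) (lie_sub_map_eq_zero hθ hp hx hu)
  have h3 : killingForm ℂ L y (θ u) = -killingForm ℂ L y u := by
    rw [← killingForm_of_equiv_apply θ y (θ u), (hp y).mp hy, hθ, map_neg, LinearMap.neg_apply]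
  rw [map_sub, h3, sub_neg_eq_add, ← two_mul, mul_eq_zero] at h2
  rw [map_add, ad_apply, h1, h2.resolve_left two_ne_zero, add_zero]

omit hθ hp [IsKilling ℂ L] in
lemma isSemisimple_ad_add {x y : L} (hx : (ad ℂ L x).IsSemisimple) (hy : (ad ℂ L y).IsSemisimple)
    (h : ⁅x, y⁆ = 0) : (ad ℂ L (x + y)).IsSemisimple := by
  rw [map_add]
  exact hx.add_of_commute (commute_ad h) hy

omit hθ hp [IsKilling ℂ L] in
/-- A Cartan subspace contains all semisimple elements of `p` commuting with it. -/
lemma IsCartanSubspace.mem_of_isSemisimple {a : Submodule ℂ L} (ha : IsCartanSubspace p a) {s : L}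
    (hs : s ∈ p) (hss : (ad ℂ L s).IsSemisimple) (h : ∀ c ∈ a, ⁅c, s⁆ = 0) : s ∈ a := by
  have h' : ∀ c ∈ a, ⁅s, c⁆ = 0 := fun c hc ↦ by rw [← lie_skew, h c hc, neg_zero]
  have hle : a ⊔ Submodule.span ℂ {s} ≤ a := by
    refine ha.le_of_ge ⟨?_, ?_, ?_⟩ le_sup_left
    · exact sup_le ha.prop.1 (Submodule.span_le.mpr (by simpa using hs))
    · intro x hx y hy
      obtain ⟨c, hc, _, hu, rfl⟩ := Submodule.mem_sup.mp hx
      obtain ⟨t, rfl⟩ := Submodule.mem_span_singleton.mp hu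
      obtain ⟨d, hd, _, hv, rfl⟩ := Submodule.mem_sup.mp hy
      obtain ⟨r, rfl⟩ := Submodule.mem_span_singleton.mp hv
      simp [ha.prop.2.1 c hc d hd, h c hc, h' d hd]
    · intro x hx
      obtain ⟨c, hc, _, hu, rfl⟩ := Submodule.mem_sup.mp hx
      obtain ⟨t, rfl⟩ := Submodule.mem_span_singleton.mp hu
      refine isSemisimple_ad_add (ha.prop.2.2 c hc) ?_ (by simp [h c hc])
      rw [map_smul]
      exact Module.End.IsSemisimple_smul t hss
  exact hle (Submodule.mem_sup_right (Submodule.mem_span_singleton_self s))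

/-- Elements of `p` commuting with a Cartan subspace `a` are sums of an element of `a` and of a
nilpotent element. -/
lemma IsCartanSubspace.exists_add {a : Submodule ℂ L} (ha : IsCartanSubspace p a) {y : L}
    (hy : y ∈ p) (h : ∀ c ∈ a, ⁅c, y⁆ = 0) :
    ∃ s ∈ a, ∃ n : L, y = n + s ∧ IsNilpotent (ad ℂ L n) := by
  obtain ⟨s, n, hys, hs, hn, hadj⟩ := IsKilling.exists_jordan_decomposition (K := ℂ) y
  have hcomm : Commute (ad ℂ L n) (ad ℂ L s) := by
    rw [← sub_eq_of_eq_add hys, map_sub]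
    exact (Algebra.commute_of_mem_adjoin_self hadj).sub_left (Commute.refl _)
  refine ⟨s, ha.mem_of_isSemisimple ?_ hs ?_, n, hys, hn⟩
  · rw [hp]
    have hconj : ∀ z : L, ad ℂ L (θ z) = θ.toLinearEquiv.conjRingEquiv (ad ℂ L z) := fun z ↦
      (conj_ad_apply θ z).symm
    have key := Module.End.isNilpotent_isSemisimple_unique (K := ℂ) (n₁ := ad ℂ L n)
      (s₁ := ad ℂ L s) (n₂ := ad ℂ L (-θ n)) (s₂ := ad ℂ L (-θ s)) hn hs ?_ ?_ hcomm ?_ ?_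
    · exact neg_eq_iff_eq_neg.mp (IsKilling.ad_injective key.2).symm
    · rw [map_neg, isNilpotent_neg_iff, hconj]
      exact hn.map _
    · rw [map_neg, Module.End.isSemisimple_neg]
      exact isSemisimple_ad_map θ hs
    · rw [map_neg, map_neg, hconj, hconj]
      exact ((hcomm.map _).neg_left).neg_right
    · rw [← map_add, ← map_add, ← hys, ← neg_add, ← map_add, ← hys, (hp y).mp hy, neg_neg]
  · intro c hc
    have h1 : Commute (ad ℂ L c) (ad ℂ L s) :=
      Algebra.commute_of_mem_adjoin_singleton_of_commute hadj (commute_ad (h c hc))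
    refine IsKilling.ad_injective (K := ℂ) ?_
    ext z
    have := LinearMap.congr_fun h1.eq z
    simp only [Module.End.mul_apply, ad_apply] at this
    simp [this]

/-- A Cartan subspace is its own centralizer in `p`: by polarization, the nilpotent elements of the
centralizer are orthogonal to the centralizer for the Killing form, so there are none but zero. -/
lemma IsCartanSubspace.mem_of_forall_lie_eq_zero {a : Submodule ℂ L} (ha : IsCartanSubspace p a)
    {y : L} (hy : y ∈ p) (h : ∀ c ∈ a, ⁅c, y⁆ = 0) : y ∈ a := by
  obtain ⟨hap, hab, hss⟩ := ha.prop
  obtain ⟨x, hx, hxa⟩ := exists_forall_lie_eq_zero hab hss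
  set B := killingForm ℂ L with hB
  have hsymm : ∀ u v, B u v = B v u := fun u v ↦ LieModule.traceForm_comm ℂ L L u v
  have hna : ∀ {n : L}, IsNilpotent (ad ℂ L n) → (∀ c ∈ a, ⁅c, n⁆ = 0) → ∀ c ∈ a, B n c = 0 :=
    fun {n} hn hc c hca ↦ killingForm_eq_zero_of_isNilpotent hn
      (by rw [← lie_skew, hc c hca, neg_zero])
  have hnn : ∀ {n : L}, IsNilpotent (ad ℂ L n) → B n n = 0 := fun {n} hn ↦
    killingForm_eq_zero_of_isNilpotent hn (lie_self n)
  -- Differences of elements of the centralizer and elements of `a` stay in the centralizer.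
  have hcen : ∀ {z s n : L}, z ∈ p → (∀ c ∈ a, ⁅c, z⁆ = 0) → s ∈ a → z = n + s →
      n ∈ p ∧ ∀ c ∈ a, ⁅c, n⁆ = 0 := by
    intro z s n hz hzc hs hzn
    rw [← sub_eq_of_eq_add hzn]
    exact ⟨p.sub_mem hz (hap hs), fun c hc ↦ by rw [lie_sub, hzc c hc, hab c hc s hs, sub_zero]⟩
  -- The form vanishes on the squares of sums of two nilpotent elements of the centralizer.
  have hsq : ∀ {n n' : L}, n ∈ p → n' ∈ p → (∀ c ∈ a, ⁅c, n⁆ = 0) → (∀ c ∈ a, ⁅c, n'⁆ = 0) →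
      IsNilpotent (ad ℂ L n) → IsNilpotent (ad ℂ L n') → B n n' = 0 := by
    intro n n' hnp hnp' hnc hnc' hn hn'
    have hc : ∀ c ∈ a, ⁅c, n + n'⁆ = 0 := fun c hc ↦ by rw [lie_add, hnc c hc, hnc' c hc, add_zero]
    obtain ⟨s, hs, m, hm, hmn⟩ := ha.exists_add hθ hp (p.add_mem hnp hnp') hc
    obtain ⟨-, hmc⟩ := hcen (p.add_mem hnp hnp') hc hs hm
    have h1 : B (n + n') s = 0 := by
      rw [map_add, LinearMap.add_apply, hna hn hnc s hs, hna hn' hnc' s hs, add_zero]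
    have h2 : B s s = 0 := by
      rw [hm, map_add, LinearMap.add_apply, hna hmn hmc s hs, zero_add] at h1
      exact h1
    have h3 : B (n + n') (n + n') = 0 := by
      rw [hm]
      simp only [map_add, LinearMap.add_apply]
      rw [hnn hmn, hna hmn hmc s hs, hsymm s m, hna hmn hmc s hs, h2]
      simp
    simp only [map_add, LinearMap.add_apply] at h3
    rw [hnn hn, hnn hn', hsymm n' n, zero_add, add_zero, ← two_mul, mul_eq_zero] at h3
    exact h3.resolve_left two_ne_zero
  obtain ⟨s, hs, n, hysn, hn⟩ := ha.exists_add hθ hp hy h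
  obtain ⟨hnp, hnc⟩ := hcen hy h hs hysn
  suffices n = 0 by rwa [hysn, this, zero_add]
  refine eq_zero_of_forall_killingForm hθ hp (hap hx) (hss x hx) hnp (hnc x hx) fun z hz hxz ↦ ?_
  have hzc := hxa z hxz
  obtain ⟨s', hs', n', hzn, hn'⟩ := ha.exists_add hθ hp hz hzc
  obtain ⟨hnp', hnc'⟩ := hcen hz hzc hs' hzn
  show B n z = 0
  rw [hzn, map_add, hna hn hnc s' hs', hsq hnp hnp' hnc hnc' hn hn', add_zero]

lemma IsCartanSubspace.exists_regular {a : Submodule ℂ L} (ha : IsCartanSubspace p a) :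
    ∃ x ∈ a, ∀ y ∈ p, ⁅x, y⁆ = 0 → y ∈ a := by
  obtain ⟨x, hx, hxa⟩ := exists_forall_lie_eq_zero ha.prop.2.1 ha.prop.2.2
  exact ⟨x, hx, fun y hy hxy ↦ ha.mem_of_forall_lie_eq_zero hθ hp hy (hxa y hxy)⟩

include hk

/-- If `x` is a regular element of a Cartan subspace `a`, then `p = [k, x] + a`. -/
lemma IsCartanSubspace.exists_eq_lie_add {a : Submodule ℂ L} (ha : IsCartanSubspace p a) {x : L}
    (hx : x ∈ a) (hreg : ∀ y ∈ p, ⁅x, y⁆ = 0 → y ∈ a) {y : L} (hy : y ∈ p) :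
    ∃ w ∈ k, ∃ c ∈ a, y = ⁅x, w⁆ + c := by
  have hxp := ha.prop.1 hx
  obtain ⟨u, hu, v, ⟨w, rfl⟩, hyu⟩ := Submodule.mem_sup.mp
    ((ha.prop.2.2 x hx).isCompl_ker_range.sup_eq_top ▸ Submodule.mem_top :
      y ∈ LinearMap.ker (ad ℂ L x) ⊔ LinearMap.range (ad ℂ L x))
  have hu : ⁅x, u⁆ = 0 := hu
  refine ⟨(2⁻¹ : ℂ) • (w + θ w), k.smul_mem _ (add_map_mem hθ hk w), (2⁻¹ : ℂ) • (u - θ u),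
    a.smul_mem _ (hreg _ (sub_map_mem hθ hp u) (lie_sub_map_eq_zero hθ hp hxp hu)), ?_⟩
  have h1 : y = (2⁻¹ : ℂ) • (y - θ y) := by
    rw [(hp y).mp hy, sub_neg_eq_add, ← two_smul ℂ, smul_smul]
    norm_num
  have h2 : y - θ y = ⁅x, w + θ w⁆ + (u - θ u) := by
    rw [← hyu, ad_apply, map_add, LieEquiv.map_lie, (hp x).mp hxp, neg_lie, lie_add]
    abel
  rw [h1, h2, smul_add, lie_smul]

omit [IsKilling ℂ L] in
lemma IsCartanSubspace.finrank_map_ad_add_le {a : Submodule ℂ L} (ha : IsCartanSubspace p a)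
    {x : L} (hx : x ∈ a) :
    Module.finrank ℂ (k.map (ad ℂ L x)) + Module.finrank ℂ a ≤ Module.finrank ℂ p := by
  rw [← Submodule.finrank_sup_add_finrank_inf_eq]
  have h1 : k.map (ad ℂ L x) ⊓ a = ⊥ := by
    rw [eq_bot_iff]
    rintro _ ⟨⟨w, -, rfl⟩, hc⟩
    exact (ha.prop.2.2 x hx).isCompl_ker_range.disjoint.le_bot
      ⟨ha.prop.2.1 x hx _ hc, LinearMap.mem_range_self _ _⟩
  rw [h1, finrank_bot, add_zero]
  refine Submodule.finrank_mono (sup_le ?_ ha.prop.1)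
  rintro _ ⟨w, hw, rfl⟩
  rw [hp, ad_apply, LieEquiv.map_lie, (hk w).mp hw, (hp x).mp (ha.prop.1 hx), neg_lie]

lemma IsCartanSubspace.finrank_le_map_ad_add {a : Submodule ℂ L} (ha : IsCartanSubspace p a)
    {x : L} (hx : x ∈ a) (hreg : ∀ y ∈ p, ⁅x, y⁆ = 0 → y ∈ a) :
    Module.finrank ℂ p ≤ Module.finrank ℂ (k.map (ad ℂ L x)) + Module.finrank ℂ a := by
  refine le_trans (Submodule.finrank_mono ?_) (Submodule.finrank_add_le_finrank_add_finrank _ _)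
  intro y hy
  obtain ⟨w, hw, c, hc, rfl⟩ := ha.exists_eq_lie_add hθ hk hp hx hreg hy
  exact Submodule.add_mem_sup ⟨w, hw, rfl⟩ hc

end SymmetricPair

/-! ### The dimension of Cartan subspaces -/

namespace SymmetricPair

open LieAlgebra Filter Topology NormedSpace

section Normed

variable {E : Type*} [NormedAddCommGroup E] [NormedSpace ℂ E] [CompleteSpace E]

/-- The exponential of a derivation is an automorphism: here `A` stands for the adjoint
representation. -/
lemma apply_exp_mul_exp {D : E →L[ℂ] E} {A : E →L[ℂ] (E →L[ℂ] E)}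
    (h : ∀ u, A (D u) = D * A u - A u * D) (x : E) : A (exp D x) * exp D = exp D * A x := by
  have hderiv : ∀ t : ℂ, HasDerivAt
      (fun t : ℂ ↦ exp (t • -D) * A (exp (t • D) x) * exp (t • D)) 0 t := by
    intro t
    have h1 := hasDerivAt_exp_smul_const (𝕂 := ℂ) (-D) t
    have h2 := hasDerivAt_exp_smul_const' (𝕂 := ℂ) D t
    have h3 : HasDerivAt (fun t : ℂ ↦ A (exp (t • D) x)) (A ((D * exp (t • D)) x)) t :=
      (A.hasFDerivAt.comp_hasDerivAt t (h2.clm_apply (hasDerivAt_const t x))).congr_deriv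
        (by simp)
    refine ((h1.mul h3).mul h2).congr_deriv ?_
    rw [mul_apply_eq_comp, h]
    simp only [Pi.mul_apply]
    noncomm_ring
  have hconst := is_const_of_deriv_eq_zero (fun t ↦ (hderiv t).differentiableAt)
    (fun t ↦ (hderiv t).deriv) 1 0
  simp only [one_smul, zero_smul, exp_zero, one_mul, mul_one, one_apply_eq_self]
    at hconst
  let _ : NormedAlgebra ℚ (E →L[ℂ] E) := NormedAlgebra.restrictScalars ℚ ℂ _
  rw [← hconst, ← mul_assoc, ← mul_assoc, ← exp_add_of_commute (Commute.neg_right rfl)]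
  simp

/-- If `E = D(W) x + a + k`, then all points near `x` are of the form `exp (D w) c + z` with `c ∈ a`
and `z ∈ k`, by the open mapping theorem for strictly differentiable maps. -/
lemma eventually_eq_exp_apply_add [FiniteDimensional ℂ E] {W : Submodule ℂ E}
    (D : E →L[ℂ] (E →L[ℂ] E)) {a k : Submodule ℂ E} {x : E} (hx : x ∈ a)
    (h : ∀ e, ∃ w ∈ W, ∃ c ∈ a, ∃ z ∈ k, e = D w x + c + z) :
    ∀ᶠ y in 𝓝 x, ∃ w ∈ W, ∃ c ∈ a, ∃ z ∈ k, y = exp (D w) c + z := by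
  let F : W × a × k → E := fun q ↦ exp (D q.1) (q.2.1 : E) + q.2.2
  let F' : W × a × k →L[ℂ] E :=
    (((ContinuousLinearMap.apply ℂ E x).comp D).comp W.subtypeL).comp
      (ContinuousLinearMap.fst ℂ W (a × k)) +
    ((a.subtypeL).comp (ContinuousLinearMap.fst ℂ a k) +
      (k.subtypeL).comp (ContinuousLinearMap.snd ℂ a k)).comp (ContinuousLinearMap.snd ℂ W (a × k))
  let q0 : W × a × k := (0, ⟨x, hx⟩, 0)
  have hF : HasStrictFDerivAt F F' q0 := by
    have h1 : HasStrictFDerivAt (fun q : W × a × k ↦ D q.1)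
        ((D.comp W.subtypeL).comp (ContinuousLinearMap.fst ℂ W (a × k))) q0 :=
      ((D.comp W.subtypeL).comp (ContinuousLinearMap.fst ℂ W (a × k))).hasStrictFDerivAt
    have h0 : D (q0.1 : E) = 0 := by simp [q0]
    have h2 : HasStrictFDerivAt (fun q : W × a × k ↦ exp (D q.1))
        ((D.comp W.subtypeL).comp (ContinuousLinearMap.fst ℂ W (a × k))) q0 := by
      have := hasStrictFDerivAt_exp_zero (𝕂 := ℂ) (𝔸 := E →L[ℂ] E)
      rw [← h0] at this
      exact (this.comp q0 h1).congr_fderiv (by ext <;> simp)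
    have h3 : HasStrictFDerivAt (fun q : W × a × k ↦ (q.2.1 : E))
        ((a.subtypeL.comp (ContinuousLinearMap.fst ℂ a k)).comp
          (ContinuousLinearMap.snd ℂ W (a × k))) q0 :=
      ((a.subtypeL.comp (ContinuousLinearMap.fst ℂ a k)).comp
        (ContinuousLinearMap.snd ℂ W (a × k))).hasStrictFDerivAt
    have h4 : HasStrictFDerivAt (fun q : W × a × k ↦ (q.2.2 : E))
        ((k.subtypeL.comp (ContinuousLinearMap.snd ℂ a k)).comp
          (ContinuousLinearMap.snd ℂ W (a × k))) q0 :=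
      ((k.subtypeL.comp (ContinuousLinearMap.snd ℂ a k)).comp
        (ContinuousLinearMap.snd ℂ W (a × k))).hasStrictFDerivAt
    refine ((h2.clm_apply h3).add h4).congr_fderiv ?_
    ext <;> simp [F', q0]
  have hsurj : F'.range = ⊤ := by
    rw [eq_top_iff]
    intro e _
    obtain ⟨w, hw, c, hc, z, hz, rfl⟩ := h e
    exact ⟨(⟨w, hw⟩, ⟨c, hc⟩, ⟨z, hz⟩), by simp [F', add_assoc]⟩
  have hq0 : F q0 = x := by simp [F, q0]
  have hmap := hF.map_nhds_eq_of_surj hsurj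
  rw [hq0] at hmap
  rw [← hmap, Filter.eventually_map]
  exact Eventually.of_forall fun q ↦
    ⟨q.1, q.1.2, q.2.1, q.2.1.2, q.2.2, q.2.2.2, rfl⟩

end Normed

/-- The rank of `f + t • g` is at least that of `f + g` for all but finitely many `t`: after
composition with suitable maps, `f + g` becomes the identity of its range and `f + t • g` becomes
`t + (1 - t) A`, which is injective unless `t / (t - 1)` is an eigenvalue of `A`. -/
lemma eventually_finrank_range_le {V W : Type*} [AddCommGroup V] [Module ℂ V]
    [FiniteDimensional ℂ V] [AddCommGroup W] [Module ℂ W] [FiniteDimensional ℂ W]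
    (f g : V →ₗ[ℂ] W) : ∀ᶠ t : ℂ in 𝓝[≠] 0,
    Module.finrank ℂ (LinearMap.range (f + g)) ≤
      Module.finrank ℂ (LinearMap.range (f + t • g)) := by
  obtain ⟨π, hπ⟩ := (LinearMap.range (f + g)).subtype.exists_leftInverse_of_injective
    (LinearMap.ker_eq_bot.mpr (Submodule.subtype_injective _))
  obtain ⟨σ, hσ⟩ := (f + g).rangeRestrict.exists_rightInverse_of_surjective
    (f + g).range_rangeRestrict
  let A : Module.End ℂ (LinearMap.range (f + g)) := π ∘ₗ f ∘ₗ σ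
  have hA : ∀ v, π (g (σ v)) = v - A v := by
    intro v
    have h1 : f (σ v) + g (σ v) = v := congr_arg Subtype.val (LinearMap.congr_fun hσ v)
    have h2 : π v = v := LinearMap.congr_fun hπ v
    rw [eq_sub_iff_add_eq']
    simp only [A, LinearMap.comp_apply]
    rw [← map_add, h1, h2]
  have hfin : ((fun μ : ℂ ↦ μ / (μ - 1)) '' {μ | A.HasEigenvalue μ}).Finite :=
    A.finite_hasEigenvalue.image _
  filter_upwards [nhdsNE_le_cofinite _ (hfin.insert 1).compl_mem_cofinite] with t ht
  rw [Set.mem_compl_iff, Set.mem_insert_iff, not_or] at ht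
  obtain ⟨ht1, ht⟩ := ht
  have ht1' : t - 1 ≠ 0 := sub_ne_zero.mpr ht1
  refine LinearMap.finrank_le_finrank_of_injective (f := (f + t • g).rangeRestrict ∘ₗ σ) ?_
  rw [← LinearMap.ker_eq_bot, LinearMap.ker_eq_bot']
  intro v hv
  by_contra hv0
  have hv' : f (σ v) + t • g (σ v) = 0 := congr_arg Subtype.val hv
  have h1 : A v + t • (v - A v) = 0 := by
    rw [← hA, ← map_smul]
    simp only [A, LinearMap.comp_apply]
    rw [← map_add, hv', map_zero]
  refine ht ⟨t / (t - 1), Module.End.hasEigenvalue_of_hasEigenvector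
    ⟨Module.End.mem_eigenspace_iff.mpr ?_, hv0⟩, ?_⟩
  · have h2 : (t - 1) • A v = t • v := by
      have h3 : t • v - (t - 1) • A v = A v + t • (v - A v) := by module
      rw [h1, sub_eq_zero] at h3
      exact h3.symm
    rw [div_eq_inv_mul, mul_smul, ← h2, smul_smul, inv_mul_cancel₀ ht1', one_smul]
  · field_simp
    ring

section LieAlgebra

variable {L : Type*} [LieRing L] [LieAlgebra ℂ L] [FiniteDimensional ℂ L]
  {θ : L ≃ₗ⁅ℂ⁆ L} (hθ : ∀ x, θ (θ x) = x) {k p : Submodule ℂ L}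
  (hk : ∀ x, x ∈ k ↔ θ x = x) (hp : ∀ x, x ∈ p ↔ θ x = -x)

include hθ hk hp

/-- If `p = [k, x] + a`, then the points of `p` close to `x` are conjugate to elements of `a` by
automorphisms commuting with `θ`, namely by exponentials of elements of `ad k`. -/
lemma eventually_exists_lieEquiv {a : Submodule ℂ L} (hap : a ≤ p) {x : L} (hx : x ∈ a)
    (h : ∀ y ∈ p, ∃ w ∈ k, ∃ c ∈ a, y = ⁅x, w⁆ + c) {v : L} (hv : v ∈ p) :
    ∀ᶠ t : ℂ in 𝓝 0, ∃ g : L ≃ₗ[ℂ] L, (∀ y z, g ⁅y, z⁆ = ⁅g y, g z⁆) ∧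
      (∀ y, g (θ y) = θ (g y)) ∧ ∃ c ∈ a, x + t • v = g c := by
  -- Any norm on the finite-dimensional space `L` will do.
  let φ := (Module.finBasis ℂ L).equivFun
  let _ : NormedAddCommGroup L := NormedAddCommGroup.induced L _ φ φ.injective
  let _ : NormedSpace ℂ L := NormedSpace.induced ℂ L _ φ
  have : CompleteSpace L := FiniteDimensional.complete ℂ L
  let D : L →L[ℂ] (L →L[ℂ] L) := LinearMap.toContinuousLinearMap
    ((LinearMap.toContinuousLinearMap : (L →ₗ[ℂ] L) ≃ₗ[ℂ] (L →L[ℂ] L)).toLinearMap ∘ₗ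
      (ad ℂ L : L →ₗ[ℂ] (L →ₗ[ℂ] L)))
  have hD : ∀ y z, D y z = ⁅y, z⁆ := fun y z ↦ rfl
  have hmem := eventually_eq_exp_apply_add (W := k) (k := k) D hx fun e ↦ by
    obtain ⟨w, hw, c, hc, hwc⟩ := h ((2⁻¹ : ℂ) • (e - θ e))
      (p.smul_mem _ (sub_map_mem hθ hp e))
    refine ⟨-w, k.neg_mem hw, c, hc, (2⁻¹ : ℂ) • (e + θ e), k.smul_mem _ (add_map_mem hθ hk e), ?_⟩
    rw [hD, neg_lie, lie_skew, ← hwc]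
    module
  have htend : Tendsto (fun t : ℂ ↦ x + t • v) (𝓝 0) (𝓝 x) := by
    have : Continuous fun t : ℂ ↦ x + t • v := by fun_prop
    simpa using this.tendsto 0
  filter_upwards [htend.eventually hmem] with t ⟨w, hw, c, hc, z, hz, hwc⟩
  let _ : NormedAlgebra ℚ (L →L[ℂ] L) := NormedAlgebra.restrictScalars ℚ ℂ _
  have hinv1 : exp (D w) * exp (-D w) = 1 := by
    rw [← exp_add_of_commute (Commute.neg_right rfl)]; simp
  have hinv2 : exp (-D w) * exp (D w) = 1 := by
    rw [← exp_add_of_commute (Commute.refl (D w)).neg_left]; simp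
  let g : L ≃ₗ[ℂ] L := LinearEquiv.ofLinearMap (exp (D w)).toLinearMap (exp (-D w)).toLinearMap
    (LinearMap.ext fun y ↦ DFunLike.congr_fun hinv1 y)
    (LinearMap.ext fun y ↦ DFunLike.congr_fun hinv2 y)
  have hg : ∀ y, g y = exp (D w) y := fun y ↦ rfl
  have hlie : ∀ y z, g ⁅y, z⁆ = ⁅g y, g z⁆ := by
    intro y z
    have := apply_exp_mul_exp (D := D w) (A := D) (fun u ↦ by
      ext z
      simp only [hD, sub_apply, mul_apply_eq_comp]
      exact (lie_lie w u z)) y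
    exact (DFunLike.congr_fun this z).symm
  have hgθ : ∀ y, g (θ y) = θ (g y) := by
    let Θ : L →L[ℂ] L := LinearMap.toContinuousLinearMap (θ : L →ₗ[ℂ] L)
    have hc : Commute (D w) Θ := by
      ext y
      show ⁅w, θ y⁆ = θ ⁅w, y⁆
      rw [LieEquiv.map_lie, (hk w).mp hw]
    exact fun y ↦ DFunLike.congr_fun hc.exp_left.eq y
  refine ⟨g, hlie, hgθ, c, hc, ?_⟩
  have hzero : z = 0 := by
    have h1 : z ∈ p := by
      rw [← sub_eq_of_eq_add' hwc]
      refine p.sub_mem (p.add_mem (hap hx) (p.smul_mem t hv)) ?_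
      rw [hp, ← hg, ← hgθ, (hp c).mp (hap hc), map_neg]
    have h2 : (2 : ℂ) • z = 0 := by
      rw [two_smul]
      nth_rw 1 [← (hk z).mp hz]
      rw [(hp z).mp h1, neg_add_cancel]
    exact (smul_eq_zero.mp h2).resolve_left two_ne_zero
  rw [hwc, hzero, add_zero, hg]

omit [FiniteDimensional ℂ L] hθ hp in
lemma finrank_map_ad_apply {g : L ≃ₗ[ℂ] L} (hg : ∀ y z, g ⁅y, z⁆ = ⁅g y, g z⁆)
    (hgθ : ∀ y, g (θ y) = θ (g y)) (c : L) :
    Module.finrank ℂ (k.map (ad ℂ L (g c))) = Module.finrank ℂ (k.map (ad ℂ L c)) := by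
  have hgk : k.map (g : L →ₗ[ℂ] L) = k := by
    ext y
    rw [Submodule.mem_map]
    constructor
    · rintro ⟨z, hz, rfl⟩
      rw [hk, LinearEquiv.coe_coe, ← hgθ, (hk z).mp hz]
    · intro hy
      refine ⟨g.symm y, ?_, by simp⟩
      rw [hk]
      apply g.injective
      rw [hgθ, g.apply_symm_apply, (hk y).mp hy]
  have : k.map (ad ℂ L (g c)) = (k.map (ad ℂ L c)).map (g : L →ₗ[ℂ] L) := by
    conv_lhs => rw [← hgk]
    rw [← Submodule.map_comp, ← Submodule.map_comp]
    congr 1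
    ext y
    exact (hg c y).symm
  rw [this]
  exact LinearEquiv.finrank_map_eq g _

variable [IsKilling ℂ L]

/-- The points of `p` near a regular element `x` of `a` are conjugate to elements of `a`. Take such
a point `y` on the line from `x` to a regular element `x'` of `a'`, for which the rank of `ad y` on
`k` is at least that of `ad x'`: the former is at most `dim p - dim a`, the latter is equal to
`dim p - dim a'`. -/
lemma IsCartanSubspace.finrank_le {a a' : Submodule ℂ L} (ha : IsCartanSubspace p a)
    (ha' : IsCartanSubspace p a') : Module.finrank ℂ a ≤ Module.finrank ℂ a' := by
  obtain ⟨x, hx, hreg⟩ := ha.exists_regular hθ hp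
  obtain ⟨x', hx', hreg'⟩ := ha'.exists_regular hθ hp
  have h1 := eventually_exists_lieEquiv hθ hk hp ha.prop.1 hx
    (fun y hy ↦ ha.exists_eq_lie_add hθ hk hp hx hreg hy) (v := x' - x)
    (p.sub_mem (ha'.prop.1 hx') (ha.prop.1 hx))
  have h2 := eventually_finrank_range_le (ad ℂ L x ∘ₗ k.subtype) (ad ℂ L (x' - x) ∘ₗ k.subtype)
  obtain ⟨t, ⟨g, hg, hgθ, c, hc, hgc⟩, ht⟩ :=
    ((h1.filter_mono nhdsWithin_le_nhds).and h2).exists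
  rw [← LinearMap.smul_comp, ← LinearMap.add_comp, ← LinearMap.add_comp, ← map_smul, ← map_add,
    ← map_add, hgc, add_sub_cancel, LinearMap.range_comp, LinearMap.range_comp,
    Submodule.range_subtype, finrank_map_ad_apply hk hg hgθ] at ht
  have h3 := ha.finrank_map_ad_add_le hθ hk hp hc
  have h4 := ha'.finrank_le_map_ad_add hθ hk hp hx' hreg'
  lia

/-- All Cartan subspaces of `p` have the same dimension. -/
theorem IsCartanSubspace.finrank_eq {a a' : Submodule ℂ L} (ha : IsCartanSubspace p a)
    (ha' : IsCartanSubspace p a') : Module.finrank ℂ a = Module.finrank ℂ a' :=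
  le_antisymm (ha.finrank_le hθ hk hp ha') (ha'.finrank_le hθ hk hp ha)

end LieAlgebra

end SymmetricPair

/-! ### Brackets of root vectors -/

namespace LieAlgebra.IsKilling

open LieModule Module

variable {K L : Type*} [Field K] [CharZero K] [LieRing L] [LieAlgebra K L]
  [IsKilling K L] [FiniteDimensional K L]
  {H : LieSubalgebra K L} [H.IsCartanSubalgebra] [IsTriangularizable K H L]

lemma exists_smul_eq_of_mem_rootSpace {α : Weight K H L} (hα : α.IsNonZero) {x y : L}
    (hx : x ∈ rootSpace H α) (hx0 : x ≠ 0) (hy : y ∈ rootSpace H α) : ∃ c : K, c • x = y := by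
  obtain ⟨c, hc⟩ := (finrank_eq_one_iff_of_nonzero' ⟨x, hx⟩ (by simpa using hx0)).mp
    (finrank_rootSpace_eq_one α hα) ⟨y, hy⟩
  exact ⟨c, congr_arg Subtype.val hc⟩

/-- The bracket of root vectors for `α` and `β` is non-zero if `α + β` is a weight: move up to the
top of the `α`-chain of `β` and down again. -/
lemma lie_ne_zero_of_rootSpace_add_ne_bot {α β : Weight K H L} (hα : α.IsNonZero)
    (hβ : β.IsNonZero) {x y : L} (hx : x ∈ rootSpace H α) (hx0 : x ≠ 0) (hy : y ∈ rootSpace H β)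
    (hy0 : y ≠ 0) (hαβ : rootSpace H (α + β : H → K) ≠ ⊥) : ⁅x, y⁆ ≠ 0 := by
  have h1 : 1 ≤ chainTopCoeff α β := by
    have := (rootSpace_zsmul_add_ne_bot_iff α β hα 1).mp (by simpa using hαβ)
    exact_mod_cast this.1
  obtain ⟨m, hm⟩ := Nat.exists_eq_add_of_le' h1
  have hle := chainTopCoeff_le_chainLength α β
  obtain ⟨v, hv, hv0⟩ := (chainTop α β).exists_ne_zero
  obtain ⟨h, e, f, ht, he, hf⟩ := exists_isSl2Triple_of_weight_isNonZero hα
  obtain rfl := ht.h_eq_coroot hα he hf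
  have prim : ht.HasPrimitiveVectorWith v (chainLength α β : K) :=
    have := lie_mem_genWeightSpace_of_mem_genWeightSpace he hv
    ⟨hv0, (chainLength_smul _ _ hv).symm, by rwa [genWeightSpace_add_chainTop _ _ hα] at this⟩
  have hmem : (toEnd K L L f ^ (m + 1)) v ∈ rootSpace H β := by
    have := toEnd_pow_apply_mem hf hv (m + 1)
    convert this using 2
    rw [coe_chainTop', hm]
    funext z
    simp
  obtain ⟨c, hc⟩ := exists_smul_eq_of_mem_rootSpace hβ hy hy0 hmem
  obtain ⟨d, hd⟩ := exists_smul_eq_of_mem_rootSpace hα hx hx0 he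
  have hbr := prim.lie_e_pow_succ_toEnd_f m
  intro h0
  rw [← hc, ← hd, smul_lie, lie_smul, h0, smul_zero, smul_zero, eq_comm, smul_eq_zero] at hbr
  rcases hbr with h | h
  · have h2 : ((m + 1 : ℕ) : K) * ((chainLength α β : ℕ) - (m : ℕ) : K) = 0 := by
      exact_mod_cast h
    rw [mul_eq_zero, Nat.cast_eq_zero, sub_eq_zero, Nat.cast_inj] at h2
    lia
  · exact prim.pow_toEnd_f_ne_zero_of_eq_nat rfl (by lia) h

lemma lie_ne_zero_of_mem_rootSpace_neg {α : Weight K H L} (hα : α.IsNonZero) {x y : L}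
    (hx : x ∈ rootSpace H α) (hx0 : x ≠ 0) (hy : y ∈ rootSpace H (-α)) (hy0 : y ≠ 0) :
    ⁅x, y⁆ ≠ 0 := by
  obtain ⟨h, e, f, ht, he, hf⟩ := exists_isSl2Triple_of_weight_isNonZero hα
  obtain ⟨c, rfl⟩ := exists_smul_eq_of_mem_rootSpace hα he ht.e_ne_zero hx
  obtain ⟨d, rfl⟩ := exists_smul_eq_of_mem_rootSpace (α := -α) hα.neg hf ht.f_ne_zero hy
  rw [smul_lie, lie_smul, ht.lie_e_f]
  exact smul_ne_zero (left_ne_zero_of_smul hx0)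
    (smul_ne_zero (left_ne_zero_of_smul hy0) ht.h_ne_zero)

/-- The exponential of a nilpotent inner derivation, evaluated on elements killed by its third
power. -/
lemma exists_lieEquiv_of_isNilpotent_ad {e : L} (he : IsNilpotent (ad K L e)) :
    ∃ φ : L ≃ₗ⁅K⁆ L, ∀ z, ⁅e, ⁅e, ⁅e, z⁆⁆⁆ = 0 → φ z = z + ⁅e, z⁆ + (2⁻¹ : K) • ⁅e, ⁅e, z⁆⁆ := by
  let _ : Module ℚ L := Module.compHom L (algebraMap ℚ K)
  let _ : LieAlgebra ℚ L := { lie_smul := fun t x y ↦ lie_smul (algebraMap ℚ K t) x y }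
  have hq : ∀ (q : ℚ) (z : L), q • z = (q : K) • z := fun q z ↦ rfl
  have hD : (LieDerivation.ad K L e).toLinearMap = ad K L e :=
    LieDerivation.coe_ad_apply_eq_ad_apply e
  have he' : IsNilpotent (LieDerivation.ad K L e).toLinearMap := by rwa [hD]
  refine ⟨LieDerivation.exp (LieDerivation.ad K L e) he', fun z hz ↦ ?_⟩
  rw [LieDerivation.exp_map_apply, hD]
  have hz' : (ad K L e) ^ 3 • z = 0 := by simpa [pow_succ] using hz
  refine (IsNilpotent.exp_smul_eq_sum hz' he).trans ?_
  simp [Finset.sum_range_succ, pow_two, hq, Nat.factorial]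

/-- The sum of two opposite root vectors is semisimple: it is conjugate to a multiple of the
coroot. -/
lemma isSemisimple_ad_add_of_mem_rootSpace [IsAlgClosed K] {α : Weight K H L} (hα : α.IsNonZero)
    {x y : L} (hx : x ∈ rootSpace H α) (hx0 : x ≠ 0) (hy : y ∈ rootSpace H (-α)) (hy0 : y ≠ 0) :
    (ad K L (x + y)).IsSemisimple := by
  obtain ⟨h, e, f, ht, he, hf⟩ := exists_isSl2Triple_of_weight_isNonZero hα
  obtain ⟨a, rfl⟩ := exists_smul_eq_of_mem_rootSpace hα he ht.e_ne_zero hx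
  obtain ⟨c, rfl⟩ := exists_smul_eq_of_mem_rootSpace (α := -α) hα.neg hf ht.f_ne_zero hy
  have ha : a ≠ 0 := left_ne_zero_of_smul hx0
  have hc : c ≠ 0 := left_ne_zero_of_smul hy0
  have hhH : h ∈ H := by rw [ht.h_eq_coroot hα he hf]; exact (coroot α).2
  obtain ⟨μ, hμ⟩ := IsAlgClosed.exists_pow_nat_eq (a * c) two_pos
  have hμ0 : μ ≠ 0 := by
    rintro rfl
    simp [ha, hc] at hμ
  -- `exp (ad (t e)) (exp (ad (s f)) (μ h)) = a e + c f` for the following `s` and `t`.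
  let s : K := c / (2 * μ)
  let t : K := -μ / c
  obtain ⟨φ, hφ⟩ := exists_lieEquiv_of_isNilpotent_ad (e := s • f) (K := K)
    (isNilpotent_ad_of_mem_rootSpace H (χ := -α) (by simpa using hα)
      (Submodule.smul_mem _ s hf))
  obtain ⟨ψ, hψ⟩ := exists_lieEquiv_of_isNilpotent_ad (e := t • e) (K := K)
    (isNilpotent_ad_of_mem_rootSpace H (χ := α) (by simpa using hα)
      (Submodule.smul_mem _ t he))
  have hfh : ⁅f, h⁆ = (2 : K) • f := by
    rw [← lie_skew, ht.lie_lie_smul_f K, neg_neg]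
  have heh : ⁅e, h⁆ = -((2 : K) • e) := by rw [← lie_skew, ht.lie_h_e_smul K]
  have h1 : φ (μ • h) = μ • h + c • f := by
    rw [hφ]
    · simp only [smul_lie, lie_smul, hfh, lie_self, smul_zero, add_zero, smul_smul]
      congr 2
      simp only [s]
      field_simp
    · simp [hfh]
  have h2 : ψ (μ • h + c • f) = a • e + c • f := by
    rw [hψ]
    · simp only [lie_add, smul_lie, lie_smul, heh, ht.lie_e_f, lie_neg, lie_self, smul_zero,
        neg_zero, zero_add]
      have : a = μ ^ 2 / c := by field_simp; exact hμ.symm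
      subst this
      simp only [t]
      match_scalars <;> field_simp <;> ring
    · simp [heh, ht.lie_e_f]
  have hss : (ad K L (μ • h)).IsSemisimple :=
    isSemisimple_ad_of_mem_isCartanSubalgebra (H.smul_mem μ hhH)
  have key : ∀ (χ : L ≃ₗ⁅K⁆ L) {z : L}, (ad K L z).IsSemisimple → (ad K L (χ z)).IsSemisimple := by
    intro χ z hz
    refine (LinearEquiv.isSemisimple_iff _ _ χ.toLinearEquiv ?_).mp hz
    ext w
    exact LieEquiv.map_lie χ z w
  rw [← h2, ← h1]
  exact key ψ (key φ hss)

end LieAlgebra.IsKilling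

/-! ### Sums of root spaces and involutions -/

namespace LieAlgebra

open LieModule Module

/-- A decomposition `L = k ⊕ p` with `[k, k] ⊆ k`, `[k, p] ⊆ p` and `[p, p] ⊆ k` comes from an
involution of `L`. -/
lemma exists_involution {K L : Type*} [Field K] [CharZero K] [LieRing L] [LieAlgebra K L]
    {k p : Submodule K L} (h : IsCompl k p)
    (hkk : ∀ x ∈ k, ∀ y ∈ k, ⁅x, y⁆ ∈ k) (hkp : ∀ x ∈ k, ∀ y ∈ p, ⁅x, y⁆ ∈ p)
    (hpp : ∀ x ∈ p, ∀ y ∈ p, ⁅x, y⁆ ∈ k) :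
    ∃ θ : L ≃ₗ⁅K⁆ L, (∀ x, θ (θ x) = x) ∧ (∀ x, x ∈ k ↔ θ x = x) ∧ ∀ x, x ∈ p ↔ θ x = -x := by
  let T : L →ₗ[K] L := (2 : K) • k.projection p h - LinearMap.id
  have hTk : ∀ x ∈ k, T x = x := by
    intro x hx
    simp [T, Submodule.projection_apply_of_mem_left h hx, two_smul]
  have hTp : ∀ x ∈ p, T x = -x := by
    intro x hx
    simp [T, Submodule.projection_apply_of_mem_right h hx]
  have hsum : ∀ x, ∃ y ∈ k, ∃ z ∈ p, y + z = x := fun x ↦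
    Submodule.mem_sup.mp (h.sup_eq_top ▸ Submodule.mem_top)
  have hTT : ∀ x, T (T x) = x := by
    intro x
    obtain ⟨y, hy, z, hz, rfl⟩ := hsum x
    simp [hTk y hy, hTp z hz]
  have hlie : ∀ x y, T ⁅x, y⁆ = ⁅T x, T y⁆ := by
    intro x y
    obtain ⟨x₁, hx₁, x₂, hx₂, rfl⟩ := hsum x
    obtain ⟨y₁, hy₁, y₂, hy₂, rfl⟩ := hsum y
    have h21 : T ⁅x₂, y₁⁆ = -⁅x₂, y₁⁆ := by
      rw [← lie_skew, map_neg, hTp _ (hkp _ hy₁ _ hx₂)]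
    simp only [lie_add, add_lie, map_add, hTk _ hx₁, hTp _ hx₂, hTk _ hy₁, hTp _ hy₂,
      hTk _ (hkk _ hx₁ _ hy₁), hTp _ (hkp _ hx₁ _ hy₂), hTk _ (hpp _ hx₂ _ hy₂), h21, lie_neg,
      neg_lie]
    abel
  let θ : L ≃ₗ⁅K⁆ L :=
    { T with
      map_lie' := fun {x y} ↦ hlie x y
      invFun := T
      left_inv := hTT
      right_inv := hTT }
  have hθ : ∀ x, θ x = T x := fun _ ↦ rfl
  have h2 : (2 : K) ≠ 0 := two_ne_zero
  refine ⟨θ, hTT, fun x ↦ ⟨hTk x, fun hx ↦ ?_⟩, fun x ↦ ⟨hTp x, fun hx ↦ ?_⟩⟩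
  · obtain ⟨y, hy, z, hz, rfl⟩ := hsum x
    rw [hθ, map_add, hTk y hy, hTp z hz, add_right_inj, neg_eq_iff_add_eq_zero, ← two_smul K,
      smul_eq_zero, or_iff_right h2] at hx
    simpa [hx] using hy
  · obtain ⟨y, hy, z, hz, rfl⟩ := hsum x
    rw [hθ, map_add, hTk y hy, hTp z hz, neg_add, add_left_inj, eq_neg_iff_add_eq_zero,
      ← two_smul K, smul_eq_zero, or_iff_right h2] at hx
    simpa [hx] using hz

variable {K L : Type*} [Field K] [LieRing L] [LieAlgebra K L]

section weightSum

variable (H : LieSubalgebra K L) [LieRing.IsNilpotent H]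

/-- The sum of the generalised weight spaces `g_χ`, for `χ` in a set `A` of functions on `H`. -/
def weightSum (A : Set (H → K)) : Submodule K L := ⨆ χ ∈ A, (rootSpace H χ).toSubmodule

variable {H} {A B C : Set (H → K)}

lemma rootSpace_le_weightSum {χ : H → K} (hχ : χ ∈ A) :
    (rootSpace H χ).toSubmodule ≤ weightSum H A :=
  le_biSup (fun χ : H → K ↦ (rootSpace H χ).toSubmodule) hχ

lemma weightSum_induction {motive : L → Prop} {x : L} (hx : x ∈ weightSum H A)
    (mem : ∀ χ ∈ A, ∀ y ∈ rootSpace H χ, motive y) (zero : motive 0)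
    (add : ∀ y z, motive y → motive z → motive (y + z)) : motive x := by
  rw [weightSum, iSup_subtype'] at hx
  exact Submodule.iSup_induction _ (motive := motive) hx (fun χ y hy ↦ mem χ χ.2 y hy) zero add

lemma lie_mem_weightSum (h : ∀ χ ∈ A, ∀ ψ ∈ B, χ + ψ ∈ C ∨ rootSpace H (χ + ψ) = ⊥) :
    ∀ x ∈ weightSum H A, ∀ y ∈ weightSum H B, ⁅x, y⁆ ∈ weightSum H C := by
  intro x hx y hy
  refine weightSum_induction (motive := fun x ↦ ⁅x, y⁆ ∈ weightSum H C) hx (fun χ hχ x hx ↦ ?_)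
    (by simp) (fun y z hy hz ↦ by simpa using add_mem hy hz)
  refine weightSum_induction (motive := fun y ↦ ⁅x, y⁆ ∈ weightSum H C) hy (fun ψ hψ y hy ↦ ?_)
    (by simp) (fun y z hy hz ↦ by simpa using add_mem hy hz)
  have hxy : ⁅x, y⁆ ∈ rootSpace H (χ + ψ) := lie_mem_genWeightSpace_of_mem_genWeightSpace hx hy
  rcases h χ hχ ψ hψ with h | h
  · exact rootSpace_le_weightSum h hxy
  · rw [h, LieSubmodule.mem_bot] at hxy
    simp [hxy]

lemma iSupIndep_rootSpace :
    iSupIndep fun χ : H → K ↦ (rootSpace H χ).toSubmodule := by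
  simpa only [LieSubmodule.iSupIndep_toSubmodule] using iSupIndep_genWeightSpace K H L

lemma isCompl_weightSum [FiniteDimensional K L] [IsTriangularizable K H L] (hAB : Disjoint A B)
    (h : ∀ χ : H → K, rootSpace H χ ≠ ⊥ → χ ∈ A ∨ χ ∈ B) :
    IsCompl (weightSum H A) (weightSum H B) := by
  refine ⟨iSupIndep_rootSpace.disjoint_biSup_biSup hAB, codisjoint_iff_le_sup.mpr ?_⟩
  have htop := LieSubmodule.iSup_toSubmodule (fun χ : H → K ↦ rootSpace H χ)
  have htop' : ⨆ χ : H → K, rootSpace H χ = ⊤ := iSup_genWeightSpace_eq_top K H L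
  rw [htop', LieSubmodule.top_toSubmodule] at htop
  rw [htop]
  refine iSup_le fun χ ↦ ?_
  by_cases hχ : rootSpace H χ = ⊥
  · simp [hχ]
  · rcases h χ hχ with h | h
    · exact (rootSpace_le_weightSum h).trans le_sup_left
    · exact (rootSpace_le_weightSum h).trans le_sup_right

variable (H) in
/-- The projection onto the generalised weight space `g_χ` along the sum of the others. -/
def rootProj [FiniteDimensional K L] [IsTriangularizable K H L] (χ : H → K) : L →ₗ[K] L :=
  (weightSum H {χ}).projection (weightSum H {χ}ᶜ)
    (isCompl_weightSum disjoint_compl_right fun _ _ ↦ em _)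

section rootProj

variable [FiniteDimensional K L] [IsTriangularizable K H L] {χ ψ : H → K}

lemma rootProj_apply_of_mem {x : L} (hx : x ∈ rootSpace H χ) : rootProj H χ x = x :=
  Submodule.projection_apply_of_mem_left _ (rootSpace_le_weightSum (Set.mem_singleton χ) hx)

lemma rootProj_apply_of_mem_of_ne (h : ψ ≠ χ) {x : L} (hx : x ∈ rootSpace H ψ) :
    rootProj H χ x = 0 :=
  Submodule.projection_apply_of_mem_right _
    (rootSpace_le_weightSum (A := {χ}ᶜ) (by simpa using h) hx)

lemma rootProj_apply_mem (x : L) : rootProj H χ x ∈ rootSpace H χ := by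
  have h : rootProj H χ x ∈ weightSum H {χ} := Submodule.projection_apply_mem _ _
  simpa [weightSum] using h

lemma rootProj_apply_of_notMem (h : χ ∉ A) {x : L} (hx : x ∈ weightSum H A) :
    rootProj H χ x = 0 :=
  weightSum_induction (motive := fun x ↦ rootProj H χ x = 0) hx
    (fun ψ hψ _ hy ↦ rootProj_apply_of_mem_of_ne (by rintro rfl; exact h hψ) hy) (map_zero _)
    fun y z hy hz ↦ by rw [map_add, hy, hz, add_zero]

lemma weightSum_univ : weightSum H (Set.univ : Set (H → K)) = ⊤ := by
  have h := isCompl_weightSum (H := H) (K := K) (Set.disjoint_empty Set.univ)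
    fun χ _ ↦ .inl (Set.mem_univ χ)
  simpa [weightSum] using h.sup_eq_top

lemma rootProj_lie {x : L} (hx : x ∈ rootSpace H χ) (y : L) :
    rootProj H ψ ⁅x, y⁆ = ⁅x, rootProj H (ψ - χ) y⁆ := by
  refine weightSum_induction (A := Set.univ)
    (motive := fun y ↦ rootProj H ψ ⁅x, y⁆ = ⁅x, rootProj H (ψ - χ) y⁆)
    (weightSum_univ (H := H) ▸ Submodule.mem_top) (fun ξ _ y hy ↦ ?_) (by simp)
    fun y z hy hz ↦ by simp [hy, hz]
  have hxy : ⁅x, y⁆ ∈ rootSpace H (χ + ξ) := lie_mem_genWeightSpace_of_mem_genWeightSpace hx hy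
  by_cases h : ξ = ψ - χ
  · subst h
    rw [add_sub_cancel] at hxy
    rw [rootProj_apply_of_mem hxy, rootProj_apply_of_mem hy]
  · rw [rootProj_apply_of_mem_of_ne h hy, lie_zero]
    exact rootProj_apply_of_mem_of_ne (fun h' ↦ h (eq_sub_of_add_eq' h')) hxy

lemma sum_rootProj (x : L) : ∑ w : Weight K H L, rootProj H w x = x := by
  refine weightSum_induction (A := Set.univ)
    (motive := fun x ↦ ∑ w : Weight K H L, rootProj H w x = x)
    (weightSum_univ (H := H) ▸ Submodule.mem_top) (fun ξ _ y hy ↦ ?_) (by simp)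
    fun y z hy hz ↦ by simp [Finset.sum_add_distrib, hy, hz]
  by_cases h : rootSpace H ξ = ⊥
  · rw [h, LieSubmodule.mem_bot] at hy
    simp [hy]
  · rw [Finset.sum_eq_single (⟨ξ, h⟩ : Weight K H L)]
    · exact rootProj_apply_of_mem hy
    · exact fun w _ hw ↦ rootProj_apply_of_mem_of_ne
        (fun h ↦ hw (DFunLike.coe_injective h.symm)) hy
    · simp

end rootProj

end weightSum

end LieAlgebra

/-! ### The symmetric pair attached to an abelian nilradical -/

namespace StandardParabolic

open LieAlgebra LieAlgebra.IsKilling LieModule Module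

variable {L : Type*} [LieRing L] [LieAlgebra ℂ L] [FiniteDimensional ℂ L] [IsSimple ℂ L]
  {H : LieSubalgebra ℂ L} [H.IsCartanSubalgebra]

lemma exists_root_eq_neg (α : H.root) : ∃ β : H.root, (β : Weight ℂ H L) = -α :=
  ⟨⟨-α, by simpa using (H.isNonZero_coe_root α).neg⟩, rfl⟩

lemma exists_root_of_rootSpace_ne_bot {χ : H → ℂ} (h : rootSpace H χ ≠ ⊥) :
    χ = 0 ∨ ∃ α : H.root, χ = (α : Weight ℂ H L) := by
  by_cases h0 : χ = 0
  · exact .inl h0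
  · exact .inr ⟨⟨⟨χ, h⟩, by simpa [Weight.IsNonZero, Weight.IsZero] using h0⟩, rfl⟩

lemma rootSpace_ne_bot (α : H.root) : rootSpace H (α : Weight ℂ H L) ≠ ⊥ :=
  (α : Weight ℂ H L).genWeightSpace_ne_bot

lemma root_ne_zero (α : H.root) : ((α : Weight ℂ H L) : H → ℂ) ≠ 0 := H.isNonZero_coe_root α

lemma coe_root_injective {α β : H.root}
    (h : ((α : Weight ℂ H L) : H → ℂ) = (β : Weight ℂ H L)) : α = β :=
  Subtype.ext (DFunLike.coe_injective h)

lemma root_eq_add_iff {α β γ : H.root} :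
    (rootSystem H).root γ = (rootSystem H).root α + (rootSystem H).root β ↔
      ((γ : Weight ℂ H L) : H → ℂ) = (α : Weight ℂ H L) + (β : Weight ℂ H L) := by
  simp [LinearMap.ext_iff, funext_iff]

lemma root_eq_sub_iff {α β γ : H.root} :
    (rootSystem H).root γ = (rootSystem H).root α - (rootSystem H).root β ↔
      ((γ : Weight ℂ H L) : H → ℂ) = (α : Weight ℂ H L) - (β : Weight ℂ H L) := by
  simp [LinearMap.ext_iff, funext_iff]

lemma root_eq_neg_iff {α β : H.root} :
    (rootSystem H).root β = -(rootSystem H).root α ↔ (β : Weight ℂ H L) = -α := by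
  simp [LinearMap.ext_iff, Weight.ext_iff]

variable (b : (rootSystem H).Base) (S : Finset H.root)

/-- The weights of `k_S`. -/
def kWeights : Set (H → ℂ) := {χ | χ = 0 ∨ ∃ α ∈ b.subRoots S, χ = (α : Weight ℂ H L)}

/-- The weights of `p_S`. -/
def pWeights : Set (H → ℂ) := {χ | ∃ α ∉ b.subRoots S, χ = (α : Weight ℂ H L)}

variable {b S}

lemma neg_mem_subRoots_iff {α β : H.root} (h : (β : Weight ℂ H L) = -α) :
    β ∈ b.subRoots S ↔ α ∈ b.subRoots S := by
  rw [← root_eq_neg_iff] at h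
  simp [RootPairing.Base.subRoots, h, -rootSystem_root_apply]

lemma mem_nilRoots_or_neg {α : H.root} (h : α ∉ b.subRoots S) :
    α ∈ b.nilRoots S ∨ ∃ β ∈ b.nilRoots S, (β : Weight ℂ H L) = -α := by
  obtain ⟨β, hβ⟩ := exists_root_eq_neg α
  by_cases hα : b.IsPos α
  · exact .inl ⟨hα, h⟩
  · refine .inr ⟨β, ⟨?_, by rwa [neg_mem_subRoots_iff hβ]⟩, hβ⟩
    rw [b.isPos_iff_coeff_nonneg, b.coeff_neg (root_eq_neg_iff.mpr hβ)]
    rw [b.isPos_iff_coeff_nonneg] at hα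
    exact neg_nonneg.mpr ((b.coeff_pos_or_neg α).resolve_left fun h ↦ hα h.le).le

variable (b S) in
lemma k_eq_weightSum : k b S = weightSum H (kWeights b S) := by
  refine le_antisymm (sup_le ?_ (iSup₂_le fun α hα ↦ rootSpace_le_weightSum (.inr ⟨α, hα, rfl⟩)))
    (iSup₂_le ?_)
  · rw [← LieSubalgebra.coe_toLieSubmodule, ← rootSpace_zero_eq]
    exact rootSpace_le_weightSum (.inl rfl)
  · rintro _ (rfl | ⟨α, hα, rfl⟩)
    · rw [rootSpace_zero_eq, LieSubalgebra.coe_toLieSubmodule]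
      exact le_sup_left
    · exact (le_biSup (fun α : H.root ↦ (rootSpace H (α : Weight ℂ H L)).toSubmodule) hα).trans
        le_sup_right

variable (b S) in
lemma p_eq_weightSum : p b S = weightSum H (pWeights b S) := by
  refine le_antisymm (sup_le (iSup₂_le fun α hα ↦ ?_) (iSup₂_le fun α hα ↦ ?_))
    (iSup₂_le ?_)
  · exact rootSpace_le_weightSum ⟨α, hα.2, rfl⟩
  · obtain ⟨β, hβ⟩ := exists_root_eq_neg α
    exact rootSpace_le_weightSum
      ⟨β, by rw [neg_mem_subRoots_iff hβ]; exact hα.2, by rw [hβ, Weight.coe_neg]⟩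
  · rintro _ ⟨α, hα, rfl⟩
    rcases mem_nilRoots_or_neg hα with h | ⟨β, h, hβ⟩
    · exact (le_biSup (fun α : H.root ↦ (rootSpace H (α : Weight ℂ H L)).toSubmodule) h).trans
        le_sup_left
    · refine le_trans ?_ le_sup_right
      rw [← neg_neg (α : Weight ℂ H L), ← hβ]
      exact le_biSup (fun α : H.root ↦ (rootSpace H (-(α : Weight ℂ H L))).toSubmodule) h

variable (b S) in
lemma isCompl_k_p : IsCompl (k b S) (p b S) := by
  rw [k_eq_weightSum, p_eq_weightSum]
  refine isCompl_weightSum (Set.disjoint_left.mpr ?_) fun χ hχ ↦ ?_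
  · rintro χ (rfl | ⟨α, hα, rfl⟩) ⟨β, hβ, h⟩
    · exact root_ne_zero β h.symm
    · exact hβ (coe_root_injective h ▸ hα)
  · rcases exists_root_of_rootSpace_ne_bot hχ with rfl | ⟨α, rfl⟩
    · exact .inl (.inl rfl)
    · by_cases hα : α ∈ b.subRoots S
      · exact .inl (.inr ⟨α, hα, rfl⟩)
      · exact .inr ⟨α, hα, rfl⟩

/-- If `u_S` is abelian, then the sum of two roots of `u_S` is not a root. -/
lemma root_ne_add_of_abelian (hu : ∀ x ∈ u b S, ∀ y ∈ u b S, ⁅x, y⁆ = 0) {α β : H.root}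
    (hα : α ∈ b.nilRoots S) (hβ : β ∈ b.nilRoots S) (γ : H.root) :
    (rootSystem H).root γ ≠ (rootSystem H).root α + (rootSystem H).root β := by
  intro h
  rw [root_eq_add_iff] at h
  obtain ⟨x, hx, hx0⟩ := (α : Weight ℂ H L).exists_ne_zero
  obtain ⟨y, hy, hy0⟩ := (β : Weight ℂ H L).exists_ne_zero
  refine lie_ne_zero_of_rootSpace_add_ne_bot (H.isNonZero_coe_root α) (H.isNonZero_coe_root β)
    hx hx0 hy hy0 (h ▸ rootSpace_ne_bot γ) (hu x ?_ y ?_)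
  · exact le_biSup (fun α : H.root ↦ (rootSpace H (α : Weight ℂ H L)).toSubmodule) hα hx
  · exact le_biSup (fun α : H.root ↦ (rootSpace H (α : Weight ℂ H L)).toSubmodule) hβ hy

/-- If `u_S` is abelian, then a root which is a sum of two roots outside `R_S` lies in `R_S`:
otherwise the relation, or its opposite, can be rearranged so that it writes a root as a sum of two
roots of `u_S`. -/
lemma mem_subRoots_of_eq_add (hu : ∀ x ∈ u b S, ∀ y ∈ u b S, ⁅x, y⁆ = 0) {α β γ : H.root}
    (hα : α ∉ b.subRoots S) (hβ : β ∉ b.subRoots S)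
    (h : (rootSystem H).root γ = (rootSystem H).root α + (rootSystem H).root β) :
    γ ∈ b.subRoots S := by
  by_contra hγ
  obtain ⟨γ', hγ'⟩ := exists_root_eq_neg γ
  rw [← root_eq_neg_iff] at hγ'
  have h0 : ∀ {i j : H.root}, i ∈ b.nilRoots S → j ∈ b.nilRoots S → ∀ k : H.root,
      (rootSystem H).root k ≠ (rootSystem H).root i + (rootSystem H).root j :=
    root_ne_add_of_abelian hu
  have hneg : ∀ {i : H.root}, i ∉ b.subRoots S → i ∈ b.nilRoots S ∨
      ∃ j ∈ b.nilRoots S, (rootSystem H).root j = -(rootSystem H).root i := fun hi ↦ by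
    simpa only [root_eq_neg_iff] using mem_nilRoots_or_neg hi
  rcases hneg hα with hα | ⟨α', hα, e⟩ <;>
    rcases hneg hβ with hβ | ⟨β', hβ, f⟩ <;>
    rcases hneg hγ with hγ | ⟨γ'', hγ, g⟩
  · exact h0 hα hβ _ h
  · exact h0 hα hβ _ h
  · refine h0 hγ hβ α ?_
    rw [h, f]; abel
  · refine h0 hγ hα β' ?_
    rw [g, f, h]; abel
  · refine h0 hγ hα β ?_
    rw [h, e]; abel
  · refine h0 hγ hβ α' ?_
    rw [g, e, h]; abel
  · refine h0 hα hβ γ' ?_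
    rw [hγ', e, f, h]; abel
  · refine h0 hα hβ γ'' ?_
    rw [g, e, f, h]; abel

/-- If `u_S` is abelian, then `k_S` and `p_S` are the eigenspaces of an involution. -/
lemma exists_involution_of_abelian (hu : ∀ x ∈ u b S, ∀ y ∈ u b S, ⁅x, y⁆ = 0) :
    ∃ θ : L ≃ₗ⁅ℂ⁆ L, (∀ x, θ (θ x) = x) ∧ (∀ x, x ∈ k b S ↔ θ x = x) ∧
      ∀ x, x ∈ p b S ↔ θ x = -x := by
  refine exists_involution (isCompl_k_p b S) ?_ ?_ ?_ <;>
    simp only [k_eq_weightSum, p_eq_weightSum] <;>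
    refine lie_mem_weightSum fun χ hχ ψ hψ ↦ or_iff_not_imp_right.mpr fun hne ↦ ?_
  · rcases exists_root_of_rootSpace_ne_bot hne with h | ⟨γ, h⟩
    · exact .inl h
    · rcases hχ with rfl | ⟨α, hα, rfl⟩
      · rwa [zero_add]
      · rcases hψ with rfl | ⟨β, hβ, rfl⟩
        · rw [add_zero]
          exact .inr ⟨α, hα, rfl⟩
        · exact .inr ⟨γ, b.add_mem_subRoots hα hβ (root_eq_add_iff.mpr h.symm), h⟩
  · obtain ⟨β, hβ, rfl⟩ := hψ
    rcases hχ with rfl | ⟨α, hα, rfl⟩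
    · exact ⟨β, hβ, zero_add _⟩
    · rcases exists_root_of_rootSpace_ne_bot hne with h | ⟨γ, h⟩
      · refine absurd ((neg_mem_subRoots_iff (β := β) ?_).mpr hα) hβ
        refine DFunLike.coe_injective ?_
        rw [Weight.coe_neg, neg_eq_of_add_eq_zero_right h]
      · refine ⟨γ, fun hγ ↦ hβ (b.sub_mem_subRoots hγ hα ?_), h⟩
        rw [root_eq_sub_iff, ← h, add_sub_cancel_left]
  · obtain ⟨α, hα, rfl⟩ := hχ
    obtain ⟨β, hβ, rfl⟩ := hψ
    rcases exists_root_of_rootSpace_ne_bot hne with h | ⟨γ, h⟩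
    · exact .inl h
    · exact .inr ⟨γ, mem_subRoots_of_eq_add hu hα hβ (root_eq_add_iff.mpr h.symm), h⟩

/-! ### The cascade and the roots of the nilradical -/

/-- A root whose coordinates dominate those of an element of `R_S¹` is in `R_S¹`. -/
lemma mem_nilRoots_of_coeff_le (hS : S ⊆ b.support) {α ε : H.root} (hα : α ∈ b.nilRoots S)
    (h : ∀ j, b.coeff α j ≤ b.coeff ε j) : ε ∈ b.nilRoots S := by
  obtain ⟨hpos, hα⟩ := hα
  rw [b.mem_subRoots_iff hS] at hα
  push Not at hα
  obtain ⟨j, hj, hne⟩ := hα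
  rw [b.isPos_iff_coeff_nonneg] at hpos
  have hj' : 0 < b.coeff ε j := ((hpos j).lt_of_ne' hne).trans_le (h j)
  refine ⟨b.isPos_of_coeff_pos hj', fun hε ↦ hj'.ne' ?_⟩
  exact (b.mem_subRoots_iff hS).mp hε j hj

lemma nilRoots_subset_iUnion_cascadeGamma (hS : S ⊆ b.support) :
    b.nilRoots S ⊆ ⋃ K ∈ b.cascadeE S, b.cascadeGamma K := by
  intro α hα
  obtain ⟨K, hK, hαK⟩ := b.exists_cascade_mem_cascadeGamma subset_rfl hα.1
    ((b.mem_subRoots_iff subset_rfl).mpr fun j hj ↦ b.coeff_eq_zero_of_notMem α hj)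
  simp only [Set.mem_iUnion]
  refine ⟨K, ⟨hK, mem_nilRoots_of_coeff_le hS hα ?_⟩, hαK⟩
  exact b.coeff_le_coeff_highestRoot hK.subset hK.isConnectedSet hαK.2.1

lemma root_ne_highestRoot_sub (hu : ∀ x ∈ u b S, ∀ y ∈ u b S, ⁅x, y⁆ = 0) (K : Finset H.root)
    {α β : H.root} (hα : α ∈ b.nilRoots S) (hβ : β ∈ b.nilRoots S) :
    (rootSystem H).root β ≠
      (rootSystem H).root (b.highestRoot K) - (rootSystem H).root α := by
  intro h
  refine root_ne_add_of_abelian hu hα hβ (b.highestRoot K) ?_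
  rw [h, add_sub_cancel]

end StandardParabolic

/-! ### The Cartan subspace spanned by the cascade -/

namespace RootPairing

variable {ι R M N : Type*} [CommRing R] [AddCommGroup M] [Module R M] [AddCommGroup N] [Module R N]
  {P : RootPairing ι R M N}

lemma IsStronglyOrthogonal.neg_left {i i' j : ι} (h : P.IsStronglyOrthogonal i j)
    (hi : P.root i' = -P.root i) : P.IsStronglyOrthogonal i' j := by
  obtain ⟨h1, h2, h3⟩ := h
  obtain rfl : i' = P.reflectionPerm i i := P.root.injective
    (by rw [hi, P.root_reflectionPerm, P.reflection_apply_self])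
  refine ⟨⟨?_, ?_⟩, fun h ↦ h3 ?_, fun h ↦ h2 ?_⟩
  · rw [P.pairing_reflectionPerm_self_left, h1.1, neg_zero]
  · rw [P.pairing_reflectionPerm_self_right, h1.2, neg_zero]
  · rw [← P.neg_mem_range_root_iff]
    convert h using 1
    rw [hi]; abel
  · rw [← P.neg_mem_range_root_iff]
    convert h using 1
    rw [hi]; abel

variable [CharZero R]

lemma IsStronglyOrthogonal.ne {i j : ι} (h : P.IsStronglyOrthogonal i j) : i ≠ j := by
  rintro rfl
  simpa using h.1.1

end RootPairing

namespace StandardParabolic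

open LieAlgebra LieAlgebra.IsKilling LieModule Module

variable {L : Type*} [LieRing L] [LieAlgebra ℂ L] [FiniteDimensional ℂ L] [IsSimple ℂ L]
  {H : LieSubalgebra ℂ L} [H.IsCartanSubalgebra]

lemma rootSpace_add_eq_bot_of_isStronglyOrthogonal {i j : H.root}
    (h : (rootSystem H).IsStronglyOrthogonal i j) :
    rootSpace H ((i : Weight ℂ H L) + (j : Weight ℂ H L) : H → ℂ) = ⊥ := by
  by_contra hne
  rcases exists_root_of_rootSpace_ne_bot hne with h0 | ⟨γ, hγ⟩
  · obtain ⟨i', hi'⟩ := exists_root_eq_neg i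
    refine (h.neg_left (root_eq_neg_iff.mpr hi')).ne (coe_root_injective ?_)
    rw [hi', Weight.coe_neg, neg_eq_of_add_eq_zero_right h0]
  · exact h.2.1 ⟨γ, root_eq_add_iff.mpr hγ.symm⟩

/-- Sums of opposite root vectors for strongly orthogonal roots commute. -/
lemma lie_add_add_eq_zero_of_isStronglyOrthogonal {i j : H.root}
    (h : (rootSystem H).IsStronglyOrthogonal i j) {x x' y y' : L}
    (hx : x ∈ rootSpace H (i : Weight ℂ H L)) (hx' : x' ∈ rootSpace H (-(i : Weight ℂ H L)))
    (hy : y ∈ rootSpace H (j : Weight ℂ H L)) (hy' : y' ∈ rootSpace H (-(j : Weight ℂ H L))) :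
    ⁅x + x', y + y'⁆ = 0 := by
  have key : ∀ {i j : H.root}, (rootSystem H).IsStronglyOrthogonal i j → ∀ {x y : L},
      x ∈ rootSpace H (i : Weight ℂ H L) → y ∈ rootSpace H (j : Weight ℂ H L) → ⁅x, y⁆ = 0 := by
    intro i j h x y hx hy
    have : ⁅x, y⁆ ∈ rootSpace H ((i : Weight ℂ H L) + (j : Weight ℂ H L) : H → ℂ) :=
      lie_mem_genWeightSpace_of_mem_genWeightSpace hx hy
    rwa [rootSpace_add_eq_bot_of_isStronglyOrthogonal h, LieSubmodule.mem_bot] at this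
  obtain ⟨i', hi'⟩ := exists_root_eq_neg i
  obtain ⟨j', hj'⟩ := exists_root_eq_neg j
  have h1 := h.neg_left (root_eq_neg_iff.mpr hi')
  have h2 := (h.symm.neg_left (root_eq_neg_iff.mpr hj')).symm
  have h3 := h2.neg_left (root_eq_neg_iff.mpr hi')
  rw [← Weight.coe_neg, ← hi'] at hx'
  rw [← Weight.coe_neg, ← hj'] at hy'
  simp [key h hx hy, key h1 hx' hy, key h2 hx hy', key h3 hx' hy']

/-- If `y` commutes with `x + x'`, where `x` and `x'` are root vectors for `e` and `-e`, then the
components of `y` at weights `a` such that `a - e` is a weight and `a - 2e` is not are zero. -/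
lemma rootProj_eq_zero_of_lie_add_eq_zero {e a : Weight ℂ H L} (he : e.IsNonZero)
    (ha : a.IsNonZero) {x x' y : L} (hx : x ∈ rootSpace H e) (hx' : x' ∈ rootSpace H (-e))
    (hx'0 : x' ≠ 0) (h : ⁅x + x', y⁆ = 0) (hae : rootSpace H (a - e : H → ℂ) ≠ ⊥)
    (haee : rootSpace H (a - e - e : H → ℂ) = ⊥) : rootProj H a y = 0 := by
  have h1 := congr_arg (rootProj H (a - e : H → ℂ)) h
  have h2 : rootProj H (a - e - e : H → ℂ) y = 0 := by
    have := rootProj_apply_mem (H := H) (χ := (a - e - e : H → ℂ)) y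
    rwa [haee, LieSubmodule.mem_bot] at this
  rw [add_lie, map_add, rootProj_lie hx, rootProj_lie hx', h2, lie_zero, zero_add, map_zero,
    sub_neg_eq_add, sub_add_cancel] at h1
  by_contra h0
  refine lie_ne_zero_of_rootSpace_add_ne_bot (α := -e) he.neg ha hx' hx'0
    (rootProj_apply_mem y) h0 ?_ h1
  rwa [Weight.coe_neg, neg_add_eq_sub]

/-- If `y` commutes with `x + x'`, where `x` and `x'` are root vectors for `e` and `-e`, then the
components of `y` at `e` and `-e` are proportional to `x` and `x'`, with the same factor. -/
lemma exists_rootProj_add_rootProj_eq {e : Weight ℂ H L} (he : e.IsNonZero) {x x' y : L}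
    (hx : x ∈ rootSpace H e) (hx0 : x ≠ 0) (hx' : x' ∈ rootSpace H (-e)) (hx'0 : x' ≠ 0)
    (h : ⁅x + x', y⁆ = 0) : ∃ c : ℂ, rootProj H e y + rootProj H (-e) y = c • (x + x') := by
  obtain ⟨c, hc⟩ := exists_smul_eq_of_mem_rootSpace he hx hx0 (rootProj_apply_mem y)
  obtain ⟨d, hd⟩ := exists_smul_eq_of_mem_rootSpace (α := -e) he.neg hx' hx'0 (rootProj_apply_mem y)
  have h1 := congr_arg (rootProj H (0 : H → ℂ)) h
  rw [Weight.coe_neg] at hd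
  rw [add_lie, map_add, rootProj_lie hx, rootProj_lie hx', map_zero, zero_sub, zero_sub, neg_neg,
    ← hc, ← hd, lie_smul, lie_smul, ← lie_skew x x', smul_neg, neg_add_eq_sub, ← sub_smul,
    smul_eq_zero, sub_eq_zero] at h1
  have h2 : c = d := h1.resolve_right fun h3 ↦
    lie_ne_zero_of_mem_rootSpace_neg he hx hx0 hx' hx'0 (by rw [← lie_skew, h3, neg_zero])
  exact ⟨c, by rw [← hc, ← hd, h2, smul_add]⟩

variable {b : (rootSystem H).Base} {S : Finset H.root}

lemma rootSpace_neg_ne_bot {χ : H → ℂ} (h : rootSpace H χ ≠ ⊥) : rootSpace H (-χ) ≠ ⊥ :=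
  (-(⟨χ, h⟩ : Weight ℂ H L)).genWeightSpace_ne_bot

lemma rootSpace_neg_eq_bot {χ : H → ℂ} (h : rootSpace H χ = ⊥) : rootSpace H (-χ) = ⊥ := by
  contrapose! h
  simpa using rootSpace_neg_ne_bot h

section cascadeGamma

variable {K : Finset H.root} (hK : K ⊆ b.support) (hc : b.IsConnectedSet K) {α : H.root}
  (hα : α ∈ b.cascadeGamma K) (hne : α ≠ b.highestRoot K)

include hK hc hα hne

/-- For `α ∈ Γ^K` different from `ε_K`, the difference `α - ε_K` is a root, as the pairing of `α`
and `ε_K` is positive. -/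
lemma rootSpace_sub_highestRoot_ne_bot :
    rootSpace H ((α : Weight ℂ H L) - (b.highestRoot K : Weight ℂ H L) : H → ℂ) ≠ ⊥ := by
  obtain ⟨hpos, hαK, hort⟩ := hα
  have h1 : 0 < (rootSystem H).pairingIn ℤ α (b.highestRoot K) := by
    rw [RootPairing.isOrthogonal_iff_pairingIn] at hort
    refine (lt_or_gt_of_ne hort).resolve_left fun hneg ↦ ?_
    have h2 := (rootSystem H).root_add_root_mem_of_pairingIn_neg hneg
      (hpos.root_ne_neg (RootPairing.Base.isPos_highestRoot hK hc))
    rw [add_comm] at h2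
    exact RootPairing.Base.highestRoot_add_notMem hK hc hαK hpos h2
  obtain ⟨γ, hγ⟩ := (rootSystem H).root_sub_root_mem_of_pairingIn_pos h1 hne
  rw [root_eq_sub_iff] at hγ
  exact hγ ▸ rootSpace_ne_bot γ

/-- For `α ∈ Γ^K` different from `ε_K`, the function `2ε_K - α` is not a root, since it is bounded
by `ε_K` coordinatewise only if `α = ε_K`; nor is it zero. -/
lemma rootSpace_sub_highestRoot_sub_eq_bot :
    rootSpace H ((α : Weight ℂ H L) - (b.highestRoot K : Weight ℂ H L) -
      (b.highestRoot K : Weight ℂ H L) : H → ℂ) = ⊥ := by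
  have hle := RootPairing.Base.coeff_le_coeff_highestRoot hK hc hα.2.1
  obtain ⟨δ, hδ⟩ := (exists_root_of_rootSpace_ne_bot
    (rootSpace_sub_highestRoot_ne_bot hK hc hα hne)).resolve_left
      fun h ↦ hne (coe_root_injective (sub_eq_zero.mp h))
  rw [hδ]
  have hδ' := b.coeff_sub (root_eq_sub_iff.mpr hδ.symm)
  by_contra h
  rcases exists_root_of_rootSpace_ne_bot h with h | ⟨γ, hγ⟩
  · obtain ⟨j, hj⟩ := hc.nonempty
    have h1 := RootPairing.Base.coeff_highestRoot_pos hK hc hj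
    rw [coe_root_injective (sub_eq_zero.mp h)] at hδ'
    have h2 := congr_fun hδ' j
    have h3 := hle j
    simp only [Pi.sub_apply] at h2
    lia
  · obtain ⟨γ', hγ'⟩ := exists_root_eq_neg γ
    have hε := RootPairing.Base.highestRoot_mem_subRoots hK hc
    have hmem : γ' ∈ b.subRoots K := (neg_mem_subRoots_iff hγ').mpr
      (b.sub_mem_subRoots (b.sub_mem_subRoots hα.2.1 hε (root_eq_sub_iff.mpr hδ.symm)) hε
        (root_eq_sub_iff.mpr hγ.symm))
    have h1 := RootPairing.Base.coeff_le_coeff_highestRoot hK hc hmem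
    rw [b.coeff_neg (root_eq_neg_iff.mpr hγ'), b.coeff_sub (root_eq_sub_iff.mpr hγ.symm), hδ'] at h1
    refine hne (b.root_injective_of_coeff (le_antisymm hle fun j ↦ ?_))
    have := h1 j
    simp only [Pi.neg_apply, Pi.sub_apply] at this
    lia

end cascadeGamma

section cascadeSpan

variable {X : Weight ℂ H L → L} (hX : ∀ α ∈ H.root, X α ∈ rootSpace H α ∧ X α ≠ 0)

include hX

lemma mem_rootSpace_neg_of_root (α : H.root) :
    X (-(α : Weight ℂ H L)) ∈ rootSpace H (-(α : Weight ℂ H L)) ∧ X (-(α : Weight ℂ H L)) ≠ 0 := by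
  obtain ⟨β, hβ⟩ := exists_root_eq_neg α
  rw [← hβ, ← Weight.coe_neg, ← hβ]
  exact hX β β.2

lemma cascadeSpan_le_p : cascadeSpan b S X ≤ p b S := by
  refine Submodule.span_le.mpr ?_
  rintro _ ⟨K, hK, rfl⟩
  refine add_mem (Submodule.mem_sup_left ?_) (Submodule.mem_sup_right ?_)
  · exact le_biSup (fun α : H.root ↦ (rootSpace H (α : Weight ℂ H L)).toSubmodule) hK.2
      (hX _ (b.highestRoot K).2).1
  · exact le_biSup (fun α : H.root ↦ (rootSpace H (-(α : Weight ℂ H L))).toSubmodule) hK.2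
      (mem_rootSpace_neg_of_root hX _).1

lemma lie_eq_zero_of_mem_cascadeSpan :
    ∀ x ∈ cascadeSpan b S X, ∀ y ∈ cascadeSpan b S X, ⁅x, y⁆ = 0 := by
  intro x hx y hy
  refine Submodule.span_induction₂ (p := fun x y _ _ ↦ ⁅x, y⁆ = 0) ?_ (by simp) (by simp)
    (fun x y z _ _ _ hx hy ↦ by simp [hx, hy]) (fun x y z _ _ _ hx hy ↦ by simp [hx, hy])
    (fun c x y _ _ h ↦ by simp [h]) (fun c x y _ _ h ↦ by simp [h]) hx hy
  rintro _ _ ⟨K, hK, rfl⟩ ⟨K', hK', rfl⟩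
  by_cases h : K = K'
  · rw [h, lie_self]
  · exact lie_add_add_eq_zero_of_isStronglyOrthogonal
      (hK.1.isStronglyOrthogonal subset_rfl hK'.1 h) (hX _ (b.highestRoot K).2).1
      (mem_rootSpace_neg_of_root hX _).1 (hX _ (b.highestRoot K').2).1
      (mem_rootSpace_neg_of_root hX _).1

lemma isSemisimple_ad_of_mem_cascadeSpan :
    ∀ x ∈ cascadeSpan b S X, (ad ℂ L x).IsSemisimple := by
  intro x hx
  refine Submodule.span_induction (p := fun x _ ↦ (ad ℂ L x).IsSemisimple) ?_
    (by simp) (fun x y hx hy h h' ↦ ?_) (fun c x _ h ↦ ?_) hx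
  · rintro _ ⟨K, hK, rfl⟩
    exact isSemisimple_ad_add_of_mem_rootSpace (H.isNonZero_coe_root (b.highestRoot K))
      (hX _ (b.highestRoot K).2).1 (hX _ (b.highestRoot K).2).2
      (mem_rootSpace_neg_of_root hX _).1 (mem_rootSpace_neg_of_root hX _).2
  · exact SymmetricPair.isSemisimple_ad_add h h' (lie_eq_zero_of_mem_cascadeSpan hX x hx y hy)
  · rw [map_smul]
    exact Module.End.IsSemisimple_smul c h

/-- For `α` in `R_S¹`, the sum of the components at `α` and `-α` of an element of `p_S` which
commutes with all `X_K` lies in the span of the `X_K`: it is zero if `α` is not one of the `ε_K`. -/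
lemma rootProj_add_rootProj_neg_mem_cascadeSpan (hS : S ⊆ b.support) {y : L}
    (hy : ∀ x ∈ cascadeSpan b S X, ⁅x, y⁆ = 0) {α : H.root} (hα : α ∈ b.nilRoots S) :
    rootProj H (α : Weight ℂ H L) y + rootProj H (-(α : Weight ℂ H L)) y ∈ cascadeSpan b S X := by
  have hmem := nilRoots_subset_iUnion_cascadeGamma hS hα
  simp only [Set.mem_iUnion] at hmem
  obtain ⟨K, hK, hαK⟩ := hmem
  have hKb := hK.1.subset
  have hKc := hK.1.isConnectedSet
  have hXmem : X (b.highestRoot K : Weight ℂ H L) + X (-(b.highestRoot K : Weight ℂ H L)) ∈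
      cascadeSpan b S X := Submodule.subset_span ⟨K, hK, rfl⟩
  obtain ⟨h1, h2⟩ := hX _ (b.highestRoot K).2
  obtain ⟨h3, h4⟩ := mem_rootSpace_neg_of_root hX (b.highestRoot K)
  have hε := H.isNonZero_coe_root (b.highestRoot K)
  by_cases hne : α = b.highestRoot K
  · subst hne
    obtain ⟨c, hc⟩ := exists_rootProj_add_rootProj_eq hε h1 h2 h3 h4 (hy _ hXmem)
    rw [hc]
    exact Submodule.smul_mem _ c hXmem
  · have h5 := rootSpace_sub_highestRoot_ne_bot hKb hKc hαK hne
    have h6 := rootSpace_sub_highestRoot_sub_eq_bot hKb hKc hαK hne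
    rw [rootProj_eq_zero_of_lie_add_eq_zero hε (H.isNonZero_coe_root α) h1 h3 h4 (hy _ hXmem) h5 h6,
      ← Weight.coe_neg, rootProj_eq_zero_of_lie_add_eq_zero hε.neg (H.isNonZero_coe_root α).neg
        (x := X (-(b.highestRoot K : Weight ℂ H L))) (x' := X (b.highestRoot K : Weight ℂ H L))
        h3 (by simpa using h1) h2 (by rw [add_comm]; exact hy _ hXmem), add_zero]
    · exact zero_mem _
    · convert rootSpace_neg_ne_bot h5 using 2
      simp only [Weight.coe_neg]
      abel
    · convert rootSpace_neg_eq_bot h6 using 2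
      simp only [Weight.coe_neg]
      abel

/-- The span of the `X_K` is its own centraliser in `p_S`. -/
lemma mem_cascadeSpan_of_forall_lie_eq_zero (hS : S ⊆ b.support) {y : L} (hyp : y ∈ p b S)
    (hy : ∀ x ∈ cascadeSpan b S X, ⁅x, y⁆ = 0) : y ∈ cascadeSpan b S X := by
  rw [p_eq_weightSum] at hyp
  have key : ∀ w : Weight ℂ H L, rootProj H w y + rootProj H (-w : Weight ℂ H L) y ∈
      cascadeSpan b S X := by
    intro w
    by_cases hw : ∃ α ∉ b.subRoots S, w = α
    · obtain ⟨α, hα, rfl⟩ := hw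
      rcases mem_nilRoots_or_neg hα with h | ⟨β, h, hβ⟩
      · exact rootProj_add_rootProj_neg_mem_cascadeSpan hX hS hy h
      · have := rootProj_add_rootProj_neg_mem_cascadeSpan hX hS hy h
        rwa [← Weight.coe_neg, hβ, neg_neg, add_comm] at this
    · rw [rootProj_apply_of_notMem (χ := w) ?_ hyp,
        rootProj_apply_of_notMem (χ := (-w : Weight ℂ H L)) ?_ hyp, add_zero]
      · exact zero_mem _
      · rintro ⟨α, hα, h⟩
        obtain ⟨β, hβ⟩ := exists_root_eq_neg α
        refine hw ⟨β, (neg_mem_subRoots_iff hβ).not.mpr hα, ?_⟩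
        rw [hβ, ← DFunLike.coe_injective h, neg_neg]
      · rintro ⟨α, hα, h⟩
        exact hw ⟨α, hα, DFunLike.coe_injective h⟩
  have h2 : (2 : ℂ) • y ∈ cascadeSpan b S X := by
    have : (2 : ℂ) • y =
        ∑ w : Weight ℂ H L, (rootProj H w y + rootProj H (-w : Weight ℂ H L) y) := by
      have h := Equiv.sum_comp (Equiv.neg (Weight ℂ H L)) fun w ↦ rootProj H w y
      simp only [Equiv.neg_apply] at h
      rw [Finset.sum_add_distrib, h, sum_rootProj, two_smul]
    rw [this]
    exact sum_mem fun w _ ↦ key w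
  simpa using Submodule.smul_mem _ (2⁻¹ : ℂ) h2

lemma isCartanSubspace_cascadeSpan (hS : S ⊆ b.support) :
    SymmetricPair.IsCartanSubspace (p b S) (cascadeSpan b S X) := by
  refine ⟨⟨cascadeSpan_le_p hX, lie_eq_zero_of_mem_cascadeSpan hX,
    isSemisimple_ad_of_mem_cascadeSpan hX⟩, fun c hc hle y hy ↦ ?_⟩
  exact mem_cascadeSpan_of_forall_lie_eq_zero hX hS (hc.1 hy)
    fun x hx ↦ hc.2.1 x (hle hx) y hy

/-- The `X_K` are linearly independent, as the roots `ε_K` are distinct and not opposite. -/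
lemma finrank_cascadeSpan : finrank ℂ (cascadeSpan b S X) = (b.cascadeE S).ncard := by
  classical
  let v : b.cascadeE S → L := fun K ↦ X (b.highestRoot K : Weight ℂ H L) +
    X (-(b.highestRoot K : Weight ℂ H L))
  have hv : LinearIndependent ℂ v := by
    rw [Fintype.linearIndependent_iff]
    intro g hg K
    have h1 := congr_arg (rootProj H (b.highestRoot K : Weight ℂ H L)) hg
    rw [map_sum, map_zero, Finset.sum_eq_single K, map_smul, map_add,
      rootProj_apply_of_mem (hX _ (b.highestRoot K).2).1,
      rootProj_apply_of_mem_of_ne ?_ (mem_rootSpace_neg_of_root hX _).1, add_zero,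
      smul_eq_zero] at h1
    · exact h1.resolve_right (hX _ (b.highestRoot K).2).2
    · exact fun h ↦ root_ne_zero (b.highestRoot K) (neg_eq_self.mp h)
    · intro K' _ hne
      have hso := K'.2.1.isStronglyOrthogonal subset_rfl K.2.1 (Subtype.coe_injective.ne hne)
      rw [map_smul, map_add, rootProj_apply_of_mem_of_ne ?_ (hX _ (b.highestRoot K').2).1,
        rootProj_apply_of_mem_of_ne ?_ (mem_rootSpace_neg_of_root hX _).1, add_zero, smul_zero]
      · intro h
        obtain ⟨β, hβ⟩ := exists_root_eq_neg (b.highestRoot K' : H.root)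
        rw [← Weight.coe_neg, ← hβ] at h
        exact (hso.neg_left (root_eq_neg_iff.mpr hβ)).ne (coe_root_injective h)
      · exact fun h ↦ hso.ne (coe_root_injective h)
    · simp
  have hspan : cascadeSpan b S X = Submodule.span ℂ (Set.range v) := by
    rw [cascadeSpan, Set.image_eq_range]
  rw [hspan, finrank_span_eq_card hv, Set.ncard_eq_toFinset_card', Set.toFinset_card]

end cascadeSpan

end StandardParabolic

theorem proposition2p1 {L : Type*} [LieRing L] [LieAlgebra ℂ L] [FiniteDimensional ℂ L]
    [LieAlgebra.IsSimple ℂ L] (H : LieSubalgebra ℂ L) [H.IsCartanSubalgebra]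
    (b : (LieAlgebra.IsKilling.rootSystem H).Base)
    (X : LieModule.Weight ℂ H L → L)
    (hX : ∀ α ∈ H.root, X α ∈ LieAlgebra.rootSpace H α ∧ X α ≠ 0)
    (S : Finset H.root) (hS : S ⊆ b.support)
    (hu : ∀ x ∈ StandardParabolic.u b S, ∀ y ∈ StandardParabolic.u b S, ⁅x, y⁆ = 0) :
    (b.nilRoots S ⊆ ⋃ K ∈ b.cascadeE S, b.cascadeGamma K) ∧
    (∀ K ∈ b.cascadeE S, ∀ α ∈ b.nilRoots S ∩ b.cascadeGamma K, ∀ β ∈ b.nilRoots S,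
      (LieAlgebra.IsKilling.rootSystem H).root β ≠
        (LieAlgebra.IsKilling.rootSystem H).root (b.highestRoot K) -
          (LieAlgebra.IsKilling.rootSystem H).root α) ∧
    SymmetricPair.IsCartanSubspace (StandardParabolic.p b S)
      (StandardParabolic.cascadeSpan b S X) ∧
    SymmetricPair.HasRank (StandardParabolic.k b S) (b.cascadeE S).ncard := by
  have hcartan := StandardParabolic.isCartanSubspace_cascadeSpan hX hS
  obtain ⟨θ, hθ, hk, hp⟩ := StandardParabolic.exists_involution_of_abelian hu
  refine ⟨StandardParabolic.nilRoots_subset_iUnion_cascadeGamma hS,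
    fun K _ α hα β hβ ↦ StandardParabolic.root_ne_highestRoot_sub hu K hα.1 hβ, hcartan,
    θ, hθ, hk, _, hp, ⟨_, hcartan⟩, fun a ha ↦ ?_⟩
  rw [← StandardParabolic.finrank_cascadeSpan hX]
  exact SymmetricPair.IsCartanSubspace.finrank_eq hθ hk hp ha hcartan

end
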